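/- **Setting.** All matrix sizes are positive integers. Let $V$ be a complex $*$-vector space (complex vector space with a conjugate-linear involution); $M_{m,n}(V)$ denotes the $m\times n$ matrices over $V$, $M_n(V)=M_{n,n}(V)$, $M_{m,n}=M_{m,n}(\mathbb C)$ with the operator norm, $v^*=[v_{j,i}^*]$, $v\oplus w=\begin{bmatrix}v&0\\0&w\end{bmatrix}$, $M_n(V)_{sa}=\{v\in M_n(V):v=v^*\}$ and $e^n=e\oplus\cdots\oplus e\in M_n(V)$. $(V,e)$ is an *absolute matrix order unit space* if it is given together with convex cones $M_n(V)^+\subseteq M_n(V)_{sa}$ (containing $0$), an element $e\in V^+=M_1(V)^+$ and maps $|\cdot|_{m,n}:M_{m,n}(V)\to M_n(V)^+$ (with $|\cdot|_n=|\cdot|_{n,n}$) such that, writing $v\le w$ for $w-v\in M_n(V)^+$: - $a^*va\in M_m(V)^+$ for $v\in M_n(V)^+$, $a\in M_{n,m}$; $V^+\cap(-V^+)=\{0\}$; for each $v\in V_{sa}$ there is $k>0$ with $ke\pm v\in V^+$; and if $u\in M_n(V)^+$, $v\in M_n(V)_{sa}$ and $ku+v\in M_n(V)^+$ for all real $k>0$,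 then $v\in M_n(V)^+$; - for every $n$ and all $u,v,w\in M_n(V)_{sa}$, $k\in\mathbb R$: $|v|_n=v$ if $v\ge0$; $|v|_n\pm v\ge 0$; $|kv|_n=|k|\,|v|_n$; if $|u-v|_n=u+v$ and $0\le w\le v$, then $|u-w|_n=u+w$; if $|u-v|_n=u+v$ and $|u-w|_n=u+w$, then $\bigl|u-|v\pm w|_n\bigr|_n=u+|v\pm w|_n$; - $|\alpha v\beta|_{r,s}\le\|\alpha\|\,\bigl||v|_{m,n}\beta\bigr|_{n,s}$ for $v\in M_{m,n}(V)$, $\alpha\in M_{r,m}$, $\beta\in M_{n,s}$; and $|v\oplus w|_{m+r,n+s}=|v|_{m,n}\oplus|w|_{r,s}$ for $v\in M_{m,n}(V)$, $w\in M_{r,s}(V)$; - with $\|v\|_n=\inf\{k>0:\begin{bmatrix}ke^n&v\\v^*&ke^n\end{bmatrix}\in M_{2n}(V)^+\}$, for all $u,v\in M_n(V)^+$: $|u-v|_n=u+v$ if and only if $\|u_1+kv_1\|_n=\max\{\|u_1\|_n,\|kv_1\|_n\}$ for all $0\le u_1\le u$, $0\le v_1\le v$ and $k\in\mathbb R$.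 Continuity in $M_n(V)$ refers to $\|\cdot\|_n$. Put $\mathcal{OP}_n(V)=\{p\in M_n(V):p^*=p,\ |2p-e^n|_n=e^n\}$ (order projections), $\mathcal{PI}_{m,n}(V)=\{v\in M_{m,n}(V):|v|_{m,n}\in\mathcal{OP}_n(V),\ |v^*|_{n,m}\in\mathcal{OP}_m(V)\}$ (partial isometries), $\mathcal U_n(V)=\{u\in M_n(V):|u|_n=e^n=|u^*|_n\}$ (unitaries), $\mathcal{PU}_n(V)=\{u\in M_n(V):|u|_n=|u^*|_n\in\mathcal{OP}_n(V)\}$ (partial unitaries), and let $\mathcal{OP}_\infty,\mathcal U_\infty,\mathcal{PU}_\infty$ be the unions over $n\ge1$, each element being taken with its size. In each of $\mathcal{OP}_n,\mathcal U_n,\mathcal{PU}_n$, $x\sim_h y$ means that $x$ and $y$ are joined by a continuous path $[0,1]\to M_n(V)$ inside that set. For $p\in\mathcal{OP}_m(V)$, $q\in\mathcal{OP}_n(V)$, $p\sim q$ means that $p=|v^*|_{n,m}$ and $q=|v|_{m,n}$ for some $v\in\mathcal{PI}_{m,n}(V)$. For $u,v$ in $\mathcal U_\infty$ (resp. $\mathcal{PU}_\infty$)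 of sizes $m,n$, $u\sim_1v$ (resp. $u\sim_Kv$) means that for some $k>\max\{m,n\}$ one has $u\oplus e^{k-m}\sim_hv\oplus e^{k-n}$ in $\mathcal U_k(V)$ (resp. $u\oplus0_{k-m}\sim_hv\oplus0_{k-n}$ in $\mathcal{PU}_k(V)$). For $(X,\sim_X)$ equal to $(\mathcal{OP}_\infty,\sim)$, $(\mathcal U_\infty,\sim_1)$, $(\mathcal{PU}_\infty,\sim_K)$, write $x\approx_X y$ if $x\oplus z\sim_X y\oplus z$ for some $z\in X$, and $(x_1,y_1)\equiv_X(x_2,y_2)$ if $x_1\oplus y_2\approx_X x_2\oplus y_1$. Then $K_0(V)$, $K_1(V)$, $K(V)$ respectively denote the sets of classes $[(x,y)]$ of $X\times X$ under $\equiv_X$, with $[(x_1,y_1)]+[(x_2,y_2)]=[(x_1\oplus x_2,y_1\oplus y_2)]$. **Theorem.** Let $(V,e)$ be an absolute matrix order unit space such that - (T) whenever $u\in\mathcal{PI}_{m,n}(V)$, $v\in\mathcal{PI}_{l,n}(V)$ and $|u|_{m,n}=|v|_{l,n}$, there is $w\in\mathcal{PI}_{m,l}(V)$ with $|w^*|_{l,m}=|u^*|_{n,m}$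 and $|w|_{m,l}=|v^*|_{n,l}$; - $|\cdot|_n:M_n(V)\to M_n(V)$ is continuous for every $n$; - for every $n$ and $p,q\in\mathcal{OP}_n(V)$, $p\sim_hq$ in $\mathcal{OP}_n(V)$ implies $p\sim q$. Then the three relations $\equiv_X$ are equivalence relations, the additions on $K_0(V)$, $K_1(V)$, $K(V)$ are well defined and make them abelian groups, and there is a surjective group homomorphism $\theta:K(V)\to K_0(V)\oplus K_1(V)$ such that for every $n$ and $u\in\mathcal{PU}_n(V)$ one has $u+e^n-|u|_n\in\mathcal U_n(V)$ and $$\theta([(u,0)])=\bigl([(|u|_n,0)],\,[(u+e^n-|u|_n,\,e)]\bigr).$$ Moreover $K(V)/\ker\theta\cong K_0(V)\oplus K_1(V)$. -/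

import Mathlib

/-!
Absolute matrix order unit spaces and their groups `K₀`, `K₁` and `K`.

`V` is a `*`-vector space: a complex vector space with a conjugate-linear involution.
All matrix sizes that occur are positive: the conditions below are imposed for sizes `≥ 1` only
(the values of `pos n`, `abs m n` at size `0` are never used).
-/

namespace AMOU

variable {V : Type*} [AddCommGroup V] [Module ℂ V]

/-- `α v` for a scalar matrix `α` and a matrix `v` over `V`. -/
def lmul {r m n : ℕ} (α : Matrix (Fin r) (Fin m) ℂ) (v : Matrix (Fin m) (Fin n) V) :
    Matrix (Fin r) (Fin n) V :=
  Matrix.of fun i j => ∑ k, α i k • v k j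

/-- `v β` for a matrix `v` over `V` and a scalar matrix `β`. -/
def rmul {m n s : ℕ} (v : Matrix (Fin m) (Fin n) V) (β : Matrix (Fin n) (Fin s) ℂ) :
    Matrix (Fin m) (Fin s) V :=
  Matrix.of fun i j => ∑ k, β k j • v i k

/-- The block matrix `[a, b; c, d]`. -/
def block {m r n s : ℕ} (a : Matrix (Fin m) (Fin n) V) (b : Matrix (Fin m) (Fin s) V)
    (c : Matrix (Fin r) (Fin n) V) (d : Matrix (Fin r) (Fin s) V) :
    Matrix (Fin (m + r)) (Fin (n + s)) V :=
  Matrix.reindex finSumFinEquiv finSumFinEquiv (Matrix.fromBlocks a b c d)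

/-- `v ⊕ w`. -/
def oplus {m n r s : ℕ} (v : Matrix (Fin m) (Fin n) V) (w : Matrix (Fin r) (Fin s) V) :
    Matrix (Fin (m + r)) (Fin (n + s)) V :=
  block v 0 0 w

/-- `eⁿ = e ⊕ ⋯ ⊕ e`. -/
def unitMat (e : V) (n : ℕ) : Matrix (Fin n) (Fin n) V := Matrix.diagonal fun _ => e

/-- A square matrix of size `m`, regarded as one of size `k = m`. -/
def castSq {m k : ℕ} (h : m = k) (v : Matrix (Fin m) (Fin m) V) : Matrix (Fin k) (Fin k) V :=
  Matrix.reindex (finCongr h) (finCongr h) v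

theorem oplus_unitMat (e : V) (m n : ℕ) :
    oplus (unitMat e m) (unitMat e n) = unitMat e (m + n) := by
  ext i j
  refine Fin.addCases (fun a => ?_) (fun a => ?_) i <;>
    refine Fin.addCases (fun b => ?_) (fun b => ?_) j <;>
    simp [oplus, block, unitMat, Matrix.diagonal_apply, Fin.ext_iff] <;> omega

theorem smul_oplus {m n r s : ℕ} (k : ℂ) (v : Matrix (Fin m) (Fin n) V)
    (w : Matrix (Fin r) (Fin s) V) : k • oplus v w = oplus (k • v) (k • w) := by
  ext i j
  refine Fin.addCases (fun a => ?_) (fun a => ?_) i <;>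
    refine Fin.addCases (fun b => ?_) (fun b => ?_) j <;> simp [oplus, block]

theorem oplus_sub_oplus {m n r s : ℕ} (v v' : Matrix (Fin m) (Fin n) V)
    (w w' : Matrix (Fin r) (Fin s) V) : oplus v w - oplus v' w' = oplus (v - v') (w - w') := by
  ext i j
  refine Fin.addCases (fun a => ?_) (fun a => ?_) i <;>
    refine Fin.addCases (fun b => ?_) (fun b => ?_) j <;> simp [oplus, block]

section opNorm
open scoped Matrix.Norms.L2Operator

/-- The operator norm of a scalar matrix between Euclidean (Hilbert) spaces. -/
noncomputable def opNorm {r m : ℕ} (α : Matrix (Fin r) (Fin m) ℂ) : ℝ := ‖α‖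

end opNorm

variable [StarAddMonoid V]

theorem conjTranspose_oplus {m n r s : ℕ} (v : Matrix (Fin m) (Fin n) V)
    (w : Matrix (Fin r) (Fin s) V) :
    (oplus v w).conjTranspose = oplus v.conjTranspose w.conjTranspose := by
  ext i j
  refine Fin.addCases (fun a => ?_) (fun a => ?_) i <;>
    refine Fin.addCases (fun b => ?_) (fun b => ?_) j <;> simp [oplus, block]

variable (V) in
/-- A matrix ordered space: cones `M_n(V)⁺ ⊆ M_n(V)_sa`, compatible with scalar compressions. -/
structure MatrixOrderedSpace where
  /-- The cone `M_n(V)⁺`. -/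
  pos : ∀ n : ℕ, Set (Matrix (Fin n) (Fin n) V)
  isHermitian_of_mem : ∀ n, 0 < n → ∀ v ∈ pos n, v.IsHermitian
  zero_mem : ∀ n, 0 < n → 0 ∈ pos n
  add_mem : ∀ n, 0 < n → ∀ v ∈ pos n, ∀ w ∈ pos n, v + w ∈ pos n
  smul_mem : ∀ n, 0 < n → ∀ k : ℝ, 0 ≤ k → ∀ v ∈ pos n, (k : ℂ) • v ∈ pos n
  conj_mem : ∀ n m, 0 < n → 0 < m → ∀ v ∈ pos n, ∀ a : Matrix (Fin n) (Fin m) ℂ,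
    lmul a.conjTranspose (rmul v a) ∈ pos m

variable (V) in
/-- A matrix order unit space; `V` is identified with `M_1(V)`. -/
structure MatrixOrderUnitSpace extends MatrixOrderedSpace V where
  /-- The order unit. -/
  e : V
  unit_mem : unitMat e 1 ∈ pos 1
  orderUnit : ∀ v : Matrix (Fin 1) (Fin 1) V, v.IsHermitian →
    ∃ k : ℝ, 0 < k ∧ (k : ℂ) • unitMat e 1 + v ∈ pos 1 ∧ (k : ℂ) • unitMat e 1 - v ∈ pos 1
  proper : ∀ v ∈ pos 1, -v ∈ pos 1 → v = 0
  archimedean : ∀ n, 0 < n → ∀ u ∈ pos n, ∀ v : Matrix (Fin n) (Fin n) V, v.IsHermitian →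
    (∀ k : ℝ, 0 < k → (k : ℂ) • u + v ∈ pos n) → v ∈ pos n

namespace MatrixOrderUnitSpace

variable (S : MatrixOrderUnitSpace V) {n : ℕ}

/-- The matrix norm `‖v‖_n = inf {k > 0 : [k eⁿ, v; v*, k eⁿ] ∈ M_{2n}(V)⁺}`. -/
noncomputable def mnorm (v : Matrix (Fin n) (Fin n) V) : ℝ :=
  sInf {k : ℝ | 0 < k ∧
    block ((k : ℂ) • unitMat S.e n) v v.conjTranspose ((k : ℂ) • unitMat S.e n) ∈ S.pos (n + n)}

/-- `u ⊥_∞ v`. -/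
def PerpInf (u v : Matrix (Fin n) (Fin n) V) : Prop :=
  ∀ k : ℝ, S.mnorm (u + (k : ℂ) • v) = max (S.mnorm u) (S.mnorm ((k : ℂ) • v))

/-- `u ⊥_∞^a v`: all `0 ≤ u₁ ≤ u` and `0 ≤ v₁ ≤ v` satisfy `u₁ ⊥_∞ v₁`. -/
def PerpInfA (u v : Matrix (Fin n) (Fin n) V) : Prop :=
  ∀ u₁ v₁ : Matrix (Fin n) (Fin n) V, u₁ ∈ S.pos n → u - u₁ ∈ S.pos n →
    v₁ ∈ S.pos n → v - v₁ ∈ S.pos n → S.PerpInf u₁ v₁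

/-- `u ∼_h v` in the set `A ⊆ M_n(V)`: there is a norm continuous path in `A` from `u` to `v`. -/
def Homotopic (A : Set (Matrix (Fin n) (Fin n) V)) (u v : Matrix (Fin n) (Fin n) V) : Prop :=
  ∃ f : unitInterval → Matrix (Fin n) (Fin n) V,
    (∀ t, f t ∈ A) ∧
    (∀ t, ∀ ε : ℝ, 0 < ε → ∃ δ : ℝ, 0 < δ ∧ ∀ s, dist s t < δ → S.mnorm (f s - f t) < ε) ∧
    f 0 = u ∧ f 1 = v

end MatrixOrderUnitSpace

/-- `(E_sa, C, |·|)` is an absolutely ordered space; `E_sa` is a real subspace of the complex vector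
space `E`, `C ⊆ E_sa` a cone, and the absolute value is the restriction of `a` to `E_sa`. -/
structure IsAbsolutelyOrdered {E : Type*} [AddCommGroup E] [Module ℂ E] (Esa C : Set E)
    (a : E → E) : Prop where
  abs_mem : ∀ v ∈ Esa, a v ∈ C
  abs_of_mem : ∀ v ∈ C, a v = v
  abs_add_mem : ∀ v ∈ Esa, a v + v ∈ C
  abs_sub_mem : ∀ v ∈ Esa, a v - v ∈ C
  abs_smul : ∀ v ∈ Esa, ∀ k : ℝ, a ((k : ℂ) • v) = ((|k| : ℝ) : ℂ) • a v
  perp_of_le : ∀ u ∈ Esa, ∀ v ∈ Esa, ∀ w ∈ Esa, a (u - v) = u + v → w ∈ C → v - w ∈ C →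
    a (u - w) = u + w
  perp_abs_add : ∀ u ∈ Esa, ∀ v ∈ Esa, ∀ w ∈ Esa, a (u - v) = u + v → a (u - w) = u + w →
    a (u - a (v + w)) = u + a (v + w)
  perp_abs_sub : ∀ u ∈ Esa, ∀ v ∈ Esa, ∀ w ∈ Esa, a (u - v) = u + v → a (u - w) = u + w →
    a (u - a (v - w)) = u + a (v - w)

variable (V) in
/-- An absolute matrix order unit space. -/
structure AbsMatrixOrderUnitSpace extends MatrixOrderUnitSpace V where
  /-- The absolute value `|·|_{m,n} : M_{m,n}(V) → M_n(V)⁺`. -/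
  abs : ∀ m n : ℕ, Matrix (Fin m) (Fin n) V → Matrix (Fin n) (Fin n) V
  abs_mem : ∀ m n, 0 < m → 0 < n → ∀ v, abs m n v ∈ pos n
  isAbsolutelyOrdered : ∀ n, 0 < n →
    IsAbsolutelyOrdered {v : Matrix (Fin n) (Fin n) V | v.IsHermitian} (pos n) (abs n n)
  abs_mul_le : ∀ r m n s, 0 < r → 0 < m → 0 < n → 0 < s →
    ∀ (α : Matrix (Fin r) (Fin m) ℂ) (v : Matrix (Fin m) (Fin n) V) (β : Matrix (Fin n) (Fin s) ℂ),
      (opNorm α : ℂ) • abs n s (rmul (abs m n v) β) - abs r s (lmul α (rmul v β)) ∈ pos s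
  abs_oplus : ∀ m n r s, 0 < m → 0 < n → 0 < r → 0 < s →
    ∀ (v : Matrix (Fin m) (Fin n) V) (w : Matrix (Fin r) (Fin s) V),
      abs (m + r) (n + s) (oplus v w) = oplus (abs m n v) (abs r s w)
  /-- `⊥ = ⊥_∞^a` on `M_n(V)⁺`, where `u ⊥ v` means `|u - v|_n = u + v`. -/
  perp_iff : ∀ n, 0 < n → ∀ u ∈ pos n, ∀ v ∈ pos n,
    (abs n n (u - v) = u + v ↔ toMatrixOrderUnitSpace.PerpInfA u v)

namespace AbsMatrixOrderUnitSpace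

variable (S : AbsMatrixOrderUnitSpace V)

/-- `OP_n(V)`: order projections. -/
def OP (n : ℕ) : Set (Matrix (Fin n) (Fin n) V) :=
  {p | p.conjTranspose = p ∧ S.abs n n ((2 : ℂ) • p - unitMat S.e n) = unitMat S.e n}

/-- `PI_{m,n}(V)`: partial isometries. -/
def PI (m n : ℕ) : Set (Matrix (Fin m) (Fin n) V) :=
  {v | S.abs m n v ∈ S.OP n ∧ S.abs n m v.conjTranspose ∈ S.OP m}

/-- `U_n(V)`: unitaries. -/
def U (n : ℕ) : Set (Matrix (Fin n) (Fin n) V) :=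
  {u | S.abs n n u = unitMat S.e n ∧ S.abs n n u.conjTranspose = unitMat S.e n}

/-- `PU_n(V)`: partial unitaries. -/
def PU (n : ℕ) : Set (Matrix (Fin n) (Fin n) V) :=
  {u | S.abs n n u = S.abs n n u.conjTranspose ∧ S.abs n n u ∈ S.OP n}

/-- Condition (T). -/
def CondT : Prop :=
  ∀ m n l : ℕ, 0 < m → 0 < n → 0 < l → ∀ u ∈ S.PI m n, ∀ v ∈ S.PI l n,
    S.abs m n u = S.abs l n v →
    ∃ w ∈ S.PI m l, S.abs l m w.conjTranspose = S.abs n m u.conjTranspose ∧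
      S.abs m l w = S.abs n l v.conjTranspose

/-- `|·|_n : M_n(V) → M_n(V)⁺` is norm continuous. -/
def AbsContinuous (n : ℕ) : Prop :=
  ∀ v : Matrix (Fin n) (Fin n) V, ∀ ε : ℝ, 0 < ε → ∃ δ : ℝ, 0 < δ ∧
    ∀ w : Matrix (Fin n) (Fin n) V, S.mnorm (w - v) < δ → S.mnorm (S.abs n n w - S.abs n n v) < ε

/-- `p ∼ q` for `p ∈ M_m(V)`, `q ∈ M_n(V)`: partial isometric equivalence. -/
def PIEquiv {m n : ℕ} (p : Matrix (Fin m) (Fin m) V) (q : Matrix (Fin n) (Fin n) V) : Prop :=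
  ∃ v ∈ S.PI m n, p = S.abs n m v.conjTranspose ∧ q = S.abs m n v

/-! Helper facts, needed for `⊕` and for the base points `0`, `e`. -/

theorem unit_mem_pos {n : ℕ} (hn : 0 < n) : unitMat S.e n ∈ S.pos n := by
  have h : ∀ m : ℕ, unitMat S.e (m + 1) ∈ S.pos (m + 1) := by
    intro m
    induction m with
    | zero => exact S.unit_mem
    | succ k ih =>
      have h1 := S.abs_oplus (k + 1) (k + 1) 1 1 k.succ_pos k.succ_pos one_pos one_pos
        (unitMat S.e (k + 1)) (unitMat S.e 1)
      rw [(S.isAbsolutelyOrdered _ k.succ_pos).abs_of_mem _ ih,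
        (S.isAbsolutelyOrdered _ one_pos).abs_of_mem _ S.unit_mem, oplus_unitMat] at h1
      rw [← h1]
      exact S.abs_mem _ _ (Nat.succ_pos _) (Nat.succ_pos _) _
  obtain ⟨m, rfl⟩ : ∃ m, n = m + 1 := ⟨n - 1, by omega⟩
  exact h m

theorem unit_mem_U {n : ℕ} (hn : 0 < n) : unitMat S.e n ∈ S.U n := by
  have h := unit_mem_pos S hn
  have h2 := (S.isAbsolutelyOrdered n hn).abs_of_mem _ h
  exact ⟨h2, by rw [S.isHermitian_of_mem n hn _ h, h2]⟩

theorem zero_mem_OP {n : ℕ} (hn : 0 < n) : (0 : Matrix (Fin n) (Fin n) V) ∈ S.OP n := by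
  have h := unit_mem_pos S hn
  have h2 := (S.isAbsolutelyOrdered n hn).abs_smul _ (S.isHermitian_of_mem n hn _ h) (-1)
  rw [(S.isAbsolutelyOrdered n hn).abs_of_mem _ h] at h2
  refine ⟨Matrix.conjTranspose_zero, ?_⟩
  simpa using h2

theorem zero_mem_PU {n : ℕ} (hn : 0 < n) : (0 : Matrix (Fin n) (Fin n) V) ∈ S.PU n := by
  have h := (S.isAbsolutelyOrdered n hn).abs_of_mem _ (S.zero_mem n hn)
  refine ⟨by rw [Matrix.conjTranspose_zero], ?_⟩
  rw [h]
  exact zero_mem_OP S hn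

theorem oplus_mem_OP {m n : ℕ} (hm : 0 < m) (hn : 0 < n) {p : Matrix (Fin m) (Fin m) V}
    {q : Matrix (Fin n) (Fin n) V} (hp : p ∈ S.OP m) (hq : q ∈ S.OP n) :
    oplus p q ∈ S.OP (m + n) := by
  refine ⟨by rw [conjTranspose_oplus, hp.1, hq.1], ?_⟩
  rw [← oplus_unitMat, smul_oplus, oplus_sub_oplus, S.abs_oplus m m n n hm hm hn hn, hp.2, hq.2]

theorem oplus_mem_U {m n : ℕ} (hm : 0 < m) (hn : 0 < n) {u : Matrix (Fin m) (Fin m) V}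
    {v : Matrix (Fin n) (Fin n) V} (hu : u ∈ S.U m) (hv : v ∈ S.U n) :
    oplus u v ∈ S.U (m + n) := by
  constructor
  · rw [S.abs_oplus m m n n hm hm hn hn, hu.1, hv.1, oplus_unitMat]
  · rw [conjTranspose_oplus, S.abs_oplus m m n n hm hm hn hn, hu.2, hv.2, oplus_unitMat]

theorem oplus_mem_PU {m n : ℕ} (hm : 0 < m) (hn : 0 < n) {u : Matrix (Fin m) (Fin m) V}
    {v : Matrix (Fin n) (Fin n) V} (hu : u ∈ S.PU m) (hv : v ∈ S.PU n) :
    oplus u v ∈ S.PU (m + n) := by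
  constructor
  · rw [conjTranspose_oplus, S.abs_oplus m m n n hm hm hn hn, S.abs_oplus m m n n hm hm hn hn,
      hu.1, hv.1]
  · rw [S.abs_oplus m m n n hm hm hn hn]
    exact oplus_mem_OP S hm hn hu.2 hv.2

/-- `OP_∞(V) = ⋃ₙ OP_n(V)`, an element being recorded together with its size. -/
structure OPInf where
  n : ℕ
  hn : 0 < n
  val : Matrix (Fin n) (Fin n) V
  mem : val ∈ S.OP n

/-- `U_∞(V) = ⋃ₙ U_n(V)`, an element being recorded together with its size. -/
structure UInf where
  n : ℕ
  hn : 0 < n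
  val : Matrix (Fin n) (Fin n) V
  mem : val ∈ S.U n

/-- `PU_∞(V) = ⋃ₙ PU_n(V)`, an element being recorded together with its size. -/
structure PUInf where
  n : ℕ
  hn : 0 < n
  val : Matrix (Fin n) (Fin n) V
  mem : val ∈ S.PU n

variable {S}

/-! ### `K₀` -/

namespace OPInf

/-- `p ⊕ q`. -/
def sum (p q : S.OPInf) : S.OPInf :=
  ⟨p.n + q.n, Nat.add_pos_left p.hn _, oplus p.val q.val, oplus_mem_OP S p.hn q.hn p.mem q.mem⟩

variable (S) in
/-- `0 ∈ OP_1(V)`. -/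
def zero : S.OPInf := ⟨1, one_pos, 0, zero_mem_OP S one_pos⟩

/-- `p ∼ q`. -/
def Sim (p q : S.OPInf) : Prop := S.PIEquiv p.val q.val

/-- `p ≈ q`. -/
def Approx (p q : S.OPInf) : Prop := ∃ r : S.OPInf, (p.sum r).Sim (q.sum r)

end OPInf

variable (S) in
/-- `(p₁, q₁) ≡ (p₂, q₂)` iff `p₁ ⊕ q₂ ≈ p₂ ⊕ q₁`. -/
def K0Rel (x y : S.OPInf × S.OPInf) : Prop := (x.1.sum y.2).Approx (y.1.sum x.2)

variable (S) in
/-- The set `K₀(V)` of classes `[(p, q)]`. -/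
def K0 : Type _ := Quot S.K0Rel

/-- The class `[(p, q)] ∈ K₀(V)`. -/
def K0.mk (p q : S.OPInf) : S.K0 := Quot.mk _ (p, q)

/-! ### `K₁` -/

namespace UInf

/-- `u ⊕ v`. -/
def sum (u v : S.UInf) : S.UInf :=
  ⟨u.n + v.n, Nat.add_pos_left u.hn _, oplus u.val v.val, oplus_mem_U S u.hn v.hn u.mem v.mem⟩

variable (S) in
/-- `e ∈ U_1(V)`. -/
def unit : S.UInf := ⟨1, one_pos, unitMat S.e 1, unit_mem_U S one_pos⟩

/-- `u ∼₁ v`: `u ⊕ e^{k-m} ∼_h v ⊕ e^{k-n}` in `U_k(V)` for some `k > max {m, n}`. -/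
def Sim (u v : S.UInf) : Prop :=
  ∃ (k a b : ℕ) (ha : u.n + a = k) (hb : v.n + b = k), max u.n v.n < k ∧
    S.Homotopic (S.U k) (castSq ha (oplus u.val (unitMat S.e a)))
      (castSq hb (oplus v.val (unitMat S.e b)))

/-- `u ≈₁ v`. -/
def Approx (u v : S.UInf) : Prop := ∃ w : S.UInf, (u.sum w).Sim (v.sum w)

end UInf

variable (S) in
/-- `(u₁, v₁) ≡₁ (u₂, v₂)` iff `u₁ ⊕ v₂ ≈₁ u₂ ⊕ v₁`. -/
def K1Rel (x y : S.UInf × S.UInf) : Prop := (x.1.sum y.2).Approx (y.1.sum x.2)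

variable (S) in
/-- The set `K₁(V)` of classes `[(u, v)]`. -/
def K1 : Type _ := Quot S.K1Rel

/-- The class `[(u, v)] ∈ K₁(V)`. -/
def K1.mk (u v : S.UInf) : S.K1 := Quot.mk _ (u, v)

/-! ### `K` -/

namespace PUInf

/-- `u ⊕ v`. -/
def sum (u v : S.PUInf) : S.PUInf :=
  ⟨u.n + v.n, Nat.add_pos_left u.hn _, oplus u.val v.val, oplus_mem_PU S u.hn v.hn u.mem v.mem⟩

variable (S) in
/-- `0 ∈ PU_1(V)`. -/
def zero : S.PUInf := ⟨1, one_pos, 0, zero_mem_PU S one_pos⟩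

/-- `u ∼_K v`: `u ⊕ 0_{k-m} ∼_h v ⊕ 0_{k-n}` in `PU_k(V)` for some `k > max {m, n}`. -/
def Sim (u v : S.PUInf) : Prop :=
  ∃ (k a b : ℕ) (ha : u.n + a = k) (hb : v.n + b = k), max u.n v.n < k ∧
    S.Homotopic (S.PU k)
      (castSq ha (oplus u.val (0 : Matrix (Fin a) (Fin a) V)))
      (castSq hb (oplus v.val (0 : Matrix (Fin b) (Fin b) V)))

/-- `u ≈_K v`. -/
def Approx (u v : S.PUInf) : Prop := ∃ w : S.PUInf, (u.sum w).Sim (v.sum w)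

/-- The order projection `|u|` of a partial unitary `u`. -/
def absProj (u : S.PUInf) : S.OPInf := ⟨u.n, u.hn, S.abs u.n u.n u.val, u.mem.2⟩

end PUInf

variable (S) in
/-- `(u₁, v₁) ≡_K (u₂, v₂)` iff `u₁ ⊕ v₂ ≈_K u₂ ⊕ v₁`. -/
def KRel (x y : S.PUInf × S.PUInf) : Prop := (x.1.sum y.2).Approx (y.1.sum x.2)

variable (S) in
/-- The set `K(V)` of classes `[(u, v)]`. -/
def K : Type _ := Quot S.KRel

/-- The class `[(u, v)] ∈ K(V)`. -/
def K.mk (u v : S.PUInf) : S.K := Quot.mk _ (u, v)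

end AbsMatrixOrderUnitSpace

end AMOU

/-! A partial unitary `u` of size `n` with absolute value `p` carries two pieces of data: the order
projection `p`, and the unitary `u + eⁿ - p` obtained by filling in the complement of `p`. Both
assignments respect direct sums. Both are norm continuous because the absolute value is, so a
homotopy of partial unitaries induces a homotopy of projections, which the last hypothesis turns
into `∼`, and a homotopy of unitaries. Padding `u` by `0` pads `p` by `0` and the unitary by `e`.
The universal property of the group completion then yields `θ`. It is onto because projections and
unitaries are themselves partial unitaries: a projection `p` maps to `([p], 0)`, a unitary `u` maps
to `([eⁿ], [u])`, and subtracting the image of the projection `eⁿ` isolates `[u]`.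

That `u + eⁿ - p` is unitary is not immediate, since the orthogonality axioms concern self-adjoint
elements only. The dilation `[0, u; u*, 0]` is self-adjoint with absolute value `|u*| ⊕ |u| = p ⊕
p`. The dilation of `eⁿ - p` has absolute value `(eⁿ - p) ⊕ (eⁿ - p)`, which is orthogonal to `p ⊕
p` because `|2p - eⁿ| = eⁿ`. Absolute values of orthogonal self-adjoint elements add up
(`IsAbsolutelyOrdered.abs_add_of_perp`), and the sum is `eⁿ ⊕ eⁿ`.

For the group structures, `⊕` is associative and commutative only up to a simultaneous permutation
of rows and columns. For `∼`, a projection with permuted columns is a partial isometry linking it to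
its permuted copy, and (T) gives transitivity. For homotopies, each transposition is joined to the
identity by scalar unitaries (`homotopic_submatrix_swap`); conjugation by these preserves unitaries
and partial unitaries because of `abs_lmul_rmul`. The rest is formal group completion. -/

open Matrix

set_option linter.unusedSectionVars false

namespace AMOU

/-! ### Calculus of scalar matrices acting on matrices over `V`. -/

section scalar

variable {V : Type*} [AddCommGroup V] [Module ℂ V] {l m n r s : ℕ}

theorem lmul_one (v : Matrix (Fin m) (Fin n) V) : lmul 1 v = v := by
  ext i j
  simp [lmul, Matrix.one_apply]

theorem rmul_one (v : Matrix (Fin m) (Fin n) V) : rmul v 1 = v := by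
  ext i j
  simp [rmul, Matrix.one_apply]

theorem lmul_lmul (α : Matrix (Fin l) (Fin r) ℂ) (β : Matrix (Fin r) (Fin m) ℂ)
    (v : Matrix (Fin m) (Fin n) V) : lmul α (lmul β v) = lmul (α * β) v := by
  ext i j
  simp only [lmul, of_apply, Matrix.mul_apply, Finset.smul_sum, Finset.sum_smul, mul_smul]
  exact Finset.sum_comm

theorem rmul_rmul (v : Matrix (Fin m) (Fin n) V) (α : Matrix (Fin n) (Fin r) ℂ)
    (β : Matrix (Fin r) (Fin l) ℂ) : rmul (rmul v α) β = rmul v (α * β) := by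
  ext i j
  simp only [rmul, of_apply, Matrix.mul_apply, Finset.smul_sum, Finset.sum_smul, mul_smul]
  rw [Finset.sum_comm]
  refine Finset.sum_congr rfl fun _ _ => Finset.sum_congr rfl fun _ _ => ?_
  rw [smul_comm]

theorem lmul_rmul (α : Matrix (Fin r) (Fin m) ℂ) (v : Matrix (Fin m) (Fin n) V)
    (β : Matrix (Fin n) (Fin s) ℂ) : lmul α (rmul v β) = rmul (lmul α v) β := by
  ext i j
  simp only [lmul, rmul, of_apply, Finset.smul_sum]
  rw [Finset.sum_comm]
  refine Finset.sum_congr rfl fun _ _ => Finset.sum_congr rfl fun _ _ => ?_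
  rw [smul_comm]

theorem lmul_add_left (α β : Matrix (Fin r) (Fin m) ℂ) (v : Matrix (Fin m) (Fin n) V) :
    lmul (α + β) v = lmul α v + lmul β v := by
  ext i j
  simp [lmul, add_smul, Finset.sum_add_distrib]

theorem lmul_smul_left (c : ℂ) (α : Matrix (Fin r) (Fin m) ℂ) (v : Matrix (Fin m) (Fin n) V) :
    lmul (c • α) v = c • lmul α v := by
  ext i j
  simp [lmul, mul_smul, Finset.smul_sum]

theorem lmul_add (α : Matrix (Fin r) (Fin m) ℂ) (v w : Matrix (Fin m) (Fin n) V) :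
    lmul α (v + w) = lmul α v + lmul α w := by
  ext i j
  simp [lmul, Finset.sum_add_distrib]

theorem lmul_smul (c : ℂ) (α : Matrix (Fin r) (Fin m) ℂ) (v : Matrix (Fin m) (Fin n) V) :
    lmul α (c • v) = c • lmul α v := by
  ext i j
  simp [lmul, Finset.smul_sum, smul_comm c]

theorem rmul_add_right (v : Matrix (Fin m) (Fin n) V) (α β : Matrix (Fin n) (Fin s) ℂ) :
    rmul v (α + β) = rmul v α + rmul v β := by
  ext i j
  simp [rmul, add_smul, Finset.sum_add_distrib]

theorem rmul_smul_right (c : ℂ) (v : Matrix (Fin m) (Fin n) V) (α : Matrix (Fin n) (Fin s) ℂ) :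
    rmul v (c • α) = c • rmul v α := by
  ext i j
  simp [rmul, mul_smul, Finset.smul_sum]

theorem rmul_smul (c : ℂ) (v : Matrix (Fin m) (Fin n) V) (α : Matrix (Fin n) (Fin s) ℂ) :
    rmul (c • v) α = c • rmul v α := by
  ext i j
  simp [rmul, Finset.smul_sum, smul_comm c]

theorem rmul_sub (v w : Matrix (Fin m) (Fin n) V) (α : Matrix (Fin n) (Fin s) ℂ) :
    rmul (v - w) α = rmul v α - rmul w α := by
  ext i j
  simp [rmul, smul_sub]

theorem lmul_sub (α : Matrix (Fin r) (Fin m) ℂ) (v w : Matrix (Fin m) (Fin n) V) :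
    lmul α (v - w) = lmul α v - lmul α w := by
  ext i j
  simp [lmul, smul_sub]

theorem lmul_rmul_unitMat (e : V) (α : Matrix (Fin r) (Fin n) ℂ) (β : Matrix (Fin n) (Fin s) ℂ) :
    lmul α (rmul (unitMat e n) β) = of fun i j => (α * β) i j • e := by
  ext i j
  simp [lmul, rmul, unitMat, Matrix.diagonal_apply, Matrix.mul_apply, Finset.sum_smul, mul_smul]

theorem lmul_rmul_unitMat_of_mul_eq_one (e : V) {α : Matrix (Fin r) (Fin n) ℂ}
    {β : Matrix (Fin n) (Fin r) ℂ} (h : α * β = 1) :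
    lmul α (rmul (unitMat e n) β) = unitMat e r := by
  rw [lmul_rmul_unitMat, h]
  ext i j
  by_cases hij : i = j <;> simp [unitMat, hij]

/-- Rows and columns are selected by multiplication with scalar matrices. -/
theorem submatrix_eq_lmul_rmul (v : Matrix (Fin m) (Fin n) V) (f : Fin r → Fin m)
    (g : Fin s → Fin n) :
    v.submatrix f g = lmul ((1 : Matrix (Fin m) (Fin m) ℂ).submatrix f id)
      (rmul v ((1 : Matrix (Fin n) (Fin n) ℂ).submatrix id g)) := by
  ext i j
  simp [lmul, rmul, Matrix.one_apply]

variable [StarAddMonoid V] [StarModule ℂ V]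

theorem conjTranspose_lmul (α : Matrix (Fin r) (Fin m) ℂ) (v : Matrix (Fin m) (Fin n) V) :
    (lmul α v)ᴴ = rmul vᴴ αᴴ := by
  ext i j
  simp [lmul, rmul, star_sum, star_smul]

theorem conjTranspose_rmul (v : Matrix (Fin m) (Fin n) V) (α : Matrix (Fin n) (Fin s) ℂ) :
    (rmul v α)ᴴ = lmul αᴴ vᴴ := by
  ext i j
  simp [lmul, rmul, star_sum, star_smul]

end scalar

/-! ### Simultaneous permutations of rows and columns. -/

section perm

variable {V : Type*} {ι κ τ : Type*}

/-- `y` arises from the square matrix `x` by a simultaneous relabelling of rows and columns. -/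
def PermEq (x : Matrix ι ι V) (y : Matrix κ κ V) : Prop := ∃ σ : κ ≃ ι, y = x.submatrix σ σ

theorem PermEq.refl (x : Matrix ι ι V) : PermEq x x := ⟨Equiv.refl _, rfl⟩

theorem PermEq.symm {x : Matrix ι ι V} {y : Matrix κ κ V} (h : PermEq x y) : PermEq y x := by
  obtain ⟨σ, rfl⟩ := h
  exact ⟨σ.symm, by simp⟩

theorem PermEq.trans {x : Matrix ι ι V} {y : Matrix κ κ V} {z : Matrix τ τ V} (h : PermEq x y)
    (h' : PermEq y z) : PermEq x z := by
  obtain ⟨σ, rfl⟩ := h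
  obtain ⟨ρ, rfl⟩ := h'
  exact ⟨ρ.trans σ, by simp [Matrix.submatrix_submatrix]⟩

theorem permEq_castSq {m k : ℕ} (h : m = k) (v : Matrix (Fin m) (Fin m) V) :
    PermEq v (castSq h v) := ⟨(finCongr h).symm, rfl⟩

variable [AddCommGroup V] {l m n : ℕ}

theorem permEq_oplus_fromBlocks (v : Matrix (Fin m) (Fin m) V) (w : Matrix (Fin n) (Fin n) V) :
    PermEq (oplus v w) (fromBlocks v 0 0 w) := ⟨finSumFinEquiv, by simp [oplus, block]⟩

theorem PermEq.fromBlocks {ι' κ' : Type*} {x : Matrix ι ι V} {y : Matrix κ κ V}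
    {x' : Matrix ι' ι' V} {y' : Matrix κ' κ' V} (h : PermEq x y) (h' : PermEq x' y') :
    PermEq (fromBlocks x 0 0 x') (fromBlocks y 0 0 y') := by
  obtain ⟨σ, rfl⟩ := h
  obtain ⟨ρ, rfl⟩ := h'
  refine ⟨Equiv.sumCongr σ ρ, ?_⟩
  ext (i | i) (j | j) <;> simp

theorem PermEq.oplus {m' n' : ℕ} {v : Matrix (Fin m) (Fin m) V} {v' : Matrix (Fin m') (Fin m') V}
    {w : Matrix (Fin n) (Fin n) V} {w' : Matrix (Fin n') (Fin n') V} (h : PermEq v v')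
    (h' : PermEq w w') : PermEq (oplus v w) (oplus v' w') :=
  (permEq_oplus_fromBlocks v w).trans ((h.fromBlocks h').trans (permEq_oplus_fromBlocks v' w').symm)

theorem permEq_oplus_comm (v : Matrix (Fin m) (Fin m) V) (w : Matrix (Fin n) (Fin n) V) :
    PermEq (oplus v w) (oplus w v) := by
  refine (permEq_oplus_fromBlocks v w).trans (PermEq.trans ?_ (permEq_oplus_fromBlocks w v).symm)
  refine ⟨Equiv.sumComm _ _, ?_⟩
  ext (i | i) (j | j) <;> simp

theorem permEq_oplus_assoc (u : Matrix (Fin l) (Fin l) V) (v : Matrix (Fin m) (Fin m) V)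
    (w : Matrix (Fin n) (Fin n) V) : PermEq (oplus (oplus u v) w) (oplus u (oplus v w)) := by
  refine (permEq_oplus_fromBlocks _ _).trans
    (PermEq.trans ?_ (permEq_oplus_fromBlocks _ _).symm)
  refine ((permEq_oplus_fromBlocks u v).fromBlocks (PermEq.refl w)).trans
    (PermEq.trans ?_ ((PermEq.refl u).fromBlocks (permEq_oplus_fromBlocks v w)).symm)
  refine ⟨(Equiv.sumAssoc _ _ _).symm, ?_⟩
  ext (i | i | i) (j | j | j) <;> simp

theorem permEq_oplus_right_comm (u : Matrix (Fin l) (Fin l) V) (v : Matrix (Fin m) (Fin m) V)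
    (w : Matrix (Fin n) (Fin n) V) : PermEq (oplus (oplus u v) w) (oplus (oplus u w) v) :=
  (permEq_oplus_assoc u v w).trans
    (((PermEq.refl u).oplus (permEq_oplus_comm v w)).trans (permEq_oplus_assoc u w v).symm)

end perm

/-! ### Block matrices and direct sums. -/

section blocks

variable {V : Type*} [AddCommGroup V] {m n r s : ℕ}

theorem block_add_block (a a' : Matrix (Fin m) (Fin n) V) (b b' : Matrix (Fin m) (Fin s) V)
    (c c' : Matrix (Fin r) (Fin n) V) (d d' : Matrix (Fin r) (Fin s) V) :
    block a b c d + block a' b' c' d' = block (a + a') (b + b') (c + c') (d + d') := by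
  ext i j
  refine Fin.addCases (fun i => ?_) (fun i => ?_) i <;>
    refine Fin.addCases (fun j => ?_) (fun j => ?_) j <;> simp [block]

theorem oplus_add_oplus (v v' : Matrix (Fin m) (Fin n) V) (w w' : Matrix (Fin r) (Fin s) V) :
    oplus v w + oplus v' w' = oplus (v + v') (w + w') := by
  simp [oplus, block_add_block]

theorem oplus_zero_zero : oplus (0 : Matrix (Fin m) (Fin n) V) (0 : Matrix (Fin r) (Fin s) V) = 0 := by
  ext i j
  refine Fin.addCases (fun i => ?_) (fun i => ?_) i <;>
    refine Fin.addCases (fun j => ?_) (fun j => ?_) j <;> simp [oplus, block]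

theorem oplus_inj {v v' : Matrix (Fin m) (Fin n) V} {w w' : Matrix (Fin r) (Fin s) V}
    (h : oplus v w = oplus v' w') : v = v' ∧ w = w' := by
  constructor
  · ext i j
    simpa [oplus, block] using congrFun₂ h (Fin.castAdd r i) (Fin.castAdd s j)
  · ext i j
    simpa [oplus, block] using congrFun₂ h (Fin.natAdd m i) (Fin.natAdd n j)

/-- `[0, v; w, 0]` is `v ⊕ w` up to an exchange of the columns. -/
theorem block_zero_diag (v w : Matrix (Fin n) (Fin n) V) :
    block 0 v w 0 = (oplus v w).submatrix id
      (finSumFinEquiv.symm.trans ((Equiv.sumComm _ _).trans finSumFinEquiv)) := by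
  ext i j
  refine Fin.addCases (fun i => ?_) (fun i => ?_) i <;>
    refine Fin.addCases (fun j => ?_) (fun j => ?_) j <;> simp [oplus, block, -Fin.natAdd_eq_addNat]

theorem oplus_swap (v w : Matrix (Fin n) (Fin n) V) :
    (oplus v w).submatrix (finSumFinEquiv.symm.trans ((Equiv.sumComm _ _).trans finSumFinEquiv))
      (finSumFinEquiv.symm.trans ((Equiv.sumComm _ _).trans finSumFinEquiv)) = oplus w v := by
  ext i j
  refine Fin.addCases (fun i => ?_) (fun i => ?_) i <;>
    refine Fin.addCases (fun j => ?_) (fun j => ?_) j <;> simp [oplus, block, -Fin.natAdd_eq_addNat]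

/-- The block matrix `[a ⊕ b, v ⊕ w; v' ⊕ w', a ⊕ b]` is `[a, v; v', a] ⊕ [b, w; w', b]` up to a
permutation. -/
theorem permEq_oplus_block (a v v' : Matrix (Fin m) (Fin m) V) (b w w' : Matrix (Fin n) (Fin n) V) :
    PermEq (oplus (block a v v' a) (block b w w' b))
      (block (oplus a b) (oplus v w) (oplus v' w') (oplus a b)) := by
  have h₁ : PermEq (fromBlocks (fromBlocks a v v' a) 0 0 (fromBlocks b w w' b))
      (oplus (block a v v' a) (block b w w' b)) := by
    refine PermEq.trans ?_ (permEq_oplus_fromBlocks _ _).symm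
    exact PermEq.fromBlocks ⟨finSumFinEquiv.symm, rfl⟩ ⟨finSumFinEquiv.symm, rfl⟩
  have h₂ : PermEq (fromBlocks (fromBlocks a 0 0 b) (fromBlocks v 0 0 w) (fromBlocks v' 0 0 w')
      (fromBlocks a 0 0 b)) (block (oplus a b) (oplus v w) (oplus v' w') (oplus a b)) := by
    refine ⟨finSumFinEquiv.symm.trans (Equiv.sumCongr finSumFinEquiv.symm finSumFinEquiv.symm), ?_⟩
    ext i j
    refine Fin.addCases (fun i => ?_) (fun i => ?_) i <;>
      refine Fin.addCases (fun j => ?_) (fun j => ?_) j <;> simp [block, oplus, -Fin.natAdd_eq_addNat]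
  refine h₁.symm.trans (PermEq.trans ⟨Equiv.sumSumSumComm _ _ _ _, ?_⟩ h₂)
  ext ((i | i) | (i | i)) ((j | j) | (j | j)) <;> simp

end blocks

end AMOU

namespace AMOU

/-! ### Orthogonality in absolutely ordered spaces. -/

section absOrder

variable {E : Type*} [AddCommGroup E] [Module ℂ E] {Esa C : Set E} {a : E → E}

theorem IsAbsolutelyOrdered.perp_symm (h : IsAbsolutelyOrdered Esa C a) {u v : E}
    (huv : u - v ∈ Esa) (hp : a (u - v) = u + v) : a (v - u) = v + u := by
  have := h.abs_smul _ huv (-1)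
  simpa [hp, add_comm] using this

/-- Self-adjoint elements whose absolute values are orthogonal are orthogonal. -/
theorem IsAbsolutelyOrdered.abs_add_of_perp (h : IsAbsolutelyOrdered Esa C a)
    (hadd : ∀ x ∈ Esa, ∀ y ∈ Esa, x + y ∈ Esa) (hsmul : ∀ x ∈ Esa, ∀ k : ℝ, (k : ℂ) • x ∈ Esa)
    (hC : C ⊆ Esa) (hCadd : ∀ x ∈ C, ∀ y ∈ C, x + y ∈ C)
    (hCsmul : ∀ x ∈ C, ∀ k : ℝ, 0 ≤ k → (k : ℂ) • x ∈ C) {u v : E} (hu : u ∈ Esa) (hv : v ∈ Esa)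
    (hp : a (a u - a v) = a u + a v) : a (u + v) = a u + a v := by
  have hsub : ∀ x ∈ Esa, ∀ y ∈ Esa, x - y ∈ Esa := fun x hx y hy => by
    simpa [sub_eq_add_neg] using hadd x hx _ (hsmul y hy (-1))
  have hhalf : (0 : ℝ) ≤ 1 / 2 := by norm_num
  -- positive and negative parts
  have parts : ∀ x ∈ Esa, ∃ y ∈ C, ∃ z ∈ C, y - z = x ∧ y + z = a x := by
    intro x hx
    refine ⟨_, hCsmul _ (h.abs_add_mem x hx) (1 / 2) hhalf, _,
      hCsmul _ (h.abs_sub_mem x hx) (1 / 2) hhalf, ?_, ?_⟩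
    · rw [← smul_sub]
      have : a x + x - (a x - x) = (2 : ℂ) • x := by rw [two_smul]; abel
      rw [this, smul_smul]
      norm_num
    · rw [← smul_add]
      have : a x + x + (a x - x) = (2 : ℂ) • a x := by rw [two_smul]; abel
      rw [this, smul_smul]
      norm_num
  obtain ⟨p, hpC, q, hqC, hu₁, hu₂⟩ := parts u hu
  obtain ⟨r, hrC, s, hsC, hv₁, hv₂⟩ := parts v hv
  -- Orthogonality to a sum of positive elements passes to each summand, since each lies below the
  -- sum.
  have mono : ∀ x ∈ C, ∀ y ∈ C, ∀ z ∈ C, a (x - (y + z)) = x + (y + z) →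
      a (x - y) = x + y ∧ a (x - z) = x + z := by
    intro x hx y hy z hz hxy
    exact ⟨h.perp_of_le x (hC hx) _ (hC (hCadd _ hy _ hz)) y (hC hy) hxy hy (by simpa),
      h.perp_of_le x (hC hx) _ (hC (hCadd _ hy _ hz)) z (hC hz) hxy hz (by simpa)⟩
  have symm : ∀ {x y : E}, x ∈ C → y ∈ C → a (x - y) = x + y → a (y - x) = y + x :=
    fun hx hy => h.perp_symm (hsub _ (hC hx) _ (hC hy))
  -- Conversely, a sum of positive elements is its own absolute value, so the additivity axiom
  -- applies to it directly.
  have join : ∀ x ∈ C, ∀ y ∈ C, ∀ z ∈ C, a (x - y) = x + y → a (x - z) = x + z →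
      a (x - (y + z)) = x + (y + z) := by
    intro x hx y hy z hz h₁ h₂
    have := h.perp_abs_add x (hC hx) y (hC hy) z (hC hz) h₁ h₂
    rwa [h.abs_of_mem _ (hCadd _ hy _ hz)] at this
  rw [← hu₂, ← hv₂] at hp
  obtain ⟨h₁, h₂⟩ := mono _ (hCadd _ hpC _ hqC) r hrC s hsC hp
  obtain ⟨hrp, hrq⟩ := mono r hrC p hpC q hqC (symm (hCadd _ hpC _ hqC) hrC h₁)
  obtain ⟨hsp, hsq⟩ := mono s hsC p hpC q hqC (symm (hCadd _ hpC _ hqC) hsC h₂)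
  have hpq : a (p - q) = p + q := by rw [hu₁, hu₂]
  have hrs : a (r - s) = r + s := by rw [hv₁, hv₂]
  -- The four parts are now orthogonal in every pair needed for `p + r ⊥ q + s`; since `u + v = (p +
  -- r) - (q + s)`, this is the claim.
  have k₁ := join p hpC q hqC s hsC hpq (symm hsC hpC hsp)
  have k₂ := join r hrC q hqC s hsC hrq hrs
  have k₃ := join _ (hCadd _ hqC _ hsC) p hpC r hrC (symm hpC (hCadd _ hqC _ hsC) k₁)
    (symm hrC (hCadd _ hqC _ hsC) k₂)
  have k₄ := symm (hCadd _ hqC _ hsC) (hCadd _ hpC _ hrC) k₃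
  rw [← hu₂, ← hv₂, ← hu₁, ← hv₁]
  convert k₄ using 1
  · congr 1; abel
  · abel

end absOrder

/-! ### Absolute values under scalar multiplication, and order projections. -/

theorem isHermitian_dilation {V : Type*} [AddCommGroup V] [StarAddMonoid V] {n : ℕ}
    (v : Matrix (Fin n) (Fin n) V) :
    (block 0 v vᴴ 0 : Matrix (Fin (n + n)) (Fin (n + n)) V).IsHermitian := by
  ext i j
  refine Fin.addCases (fun i => ?_) (fun i => ?_) i <;>
    refine Fin.addCases (fun j => ?_) (fun j => ?_) j <;>
    simp [block, -Fin.natAdd_eq_addNat]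

theorem opNorm_le_one {r m : ℕ} {α : Matrix (Fin r) (Fin m) ℂ} (h : αᴴ * α = 1) :
    opNorm α ≤ 1 := by
  open scoped Matrix.Norms.L2Operator in
  have h₁ : ‖α‖ * ‖α‖ ≤ 1 := by
    rw [← Matrix.l2_opNorm_conjTranspose_mul_self, h]
    -- For `m = 0` the identity matrix is zero and has norm `0`, not `1`.
    rcases subsingleton_or_nontrivial (Matrix (Fin m) (Fin m) ℂ) with _ | _
    · rw [Subsingleton.elim (1 : Matrix (Fin m) (Fin m) ℂ) 0, norm_zero]
      exact zero_le_one
    · exact CStarRing.norm_one.le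
  have h₂ : 0 ≤ ‖α‖ := norm_nonneg _
  change ‖α‖ ≤ 1
  nlinarith

variable {V : Type*} [AddCommGroup V] [Module ℂ V] [StarAddMonoid V] {m n r s : ℕ}

theorem MatrixOrderedSpace.submatrix_mem (S : MatrixOrderedSpace V) (hn : 0 < n) (hm : 0 < m)
    {v : Matrix (Fin n) (Fin n) V} (hv : v ∈ S.pos n) (f : Fin m → Fin n) :
    v.submatrix f f ∈ S.pos m := by
  rw [submatrix_eq_lmul_rmul]
  convert S.conj_mem n m hn hm v hv ((1 : Matrix (Fin n) (Fin n) ℂ).submatrix id f) using 2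
  simp

/-- Properness is assumed at size one only. Compressing by columns `e_i + c e_j` reduces to that
case, and polarisation with `c = 0, 1, i` recovers every entry. -/
theorem MatrixOrderUnitSpace.eq_zero_of_mem_of_neg_mem (S : MatrixOrderUnitSpace V) (hn : 0 < n)
    {v : Matrix (Fin n) (Fin n) V} (hv : v ∈ S.pos n) (hv' : -v ∈ S.pos n) : v = 0 := by
  have key : ∀ a : Matrix (Fin n) (Fin 1) ℂ, lmul aᴴ (rmul v a) = 0 := by
    intro a
    refine S.proper _ (S.conj_mem n 1 hn one_pos v hv a) ?_
    convert S.conj_mem n 1 hn one_pos _ hv' a using 1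
    ext i j
    simp [lmul, rmul]
  have key' : ∀ (i j : Fin n) (c : ℂ),
      v i i + c • v i j + star c • v j i + (star c * c) • v j j = 0 := by
    intro i j c
    have := congrFun₂ (key (of fun k _ => (if k = i then 1 else 0) + if k = j then c else 0)) 0 0
    simp only [lmul, rmul, of_apply, conjTranspose_apply, add_smul, star_add, Finset.sum_add_distrib,
      ite_smul, zero_smul, apply_ite star, star_zero, star_one, one_smul, Finset.sum_ite_eq',
      Finset.mem_univ, if_true, Matrix.zero_apply, smul_add] at this
    rw [← this, mul_smul]
    abel
  have diag : ∀ i, v i i = 0 := fun i => by simpa using key' i i 0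
  ext i j
  have h₁ : v i j + v j i = 0 := by simpa [diag] using key' i j 1
  have h₂ : Complex.I • v i j - Complex.I • v j i = 0 := by
    simpa [diag, sub_eq_add_neg] using key' i j Complex.I
  rw [← smul_sub, smul_eq_zero_iff_right Complex.I_ne_zero, sub_eq_zero] at h₂
  rw [← h₂, ← two_smul ℂ, smul_eq_zero_iff_right two_ne_zero] at h₁
  exact h₁

namespace AbsMatrixOrderUnitSpace

variable (S : AbsMatrixOrderUnitSpace V)

theorem isHermitian_unitMat (hn : 0 < n) : (unitMat S.e n).IsHermitian :=
  S.isHermitian_of_mem n hn _ (S.unit_mem_pos hn)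

theorem eq_of_sub_mem (hn : 0 < n) {v w : Matrix (Fin n) (Fin n) V} (h : v - w ∈ S.pos n)
    (h' : w - v ∈ S.pos n) : v = w :=
  sub_eq_zero.1 (S.eq_zero_of_mem_of_neg_mem hn h (by simpa using h'))

theorem abs_of_pos (hn : 0 < n) {v : Matrix (Fin n) (Fin n) V} (hv : v ∈ S.pos n) :
    S.abs n n v = v := (S.isAbsolutelyOrdered n hn).abs_of_mem v hv

/-- Positive elements equal their absolute values, so `v ⊕ w = |v| ⊕ |w| = |v ⊕ w|`, which is
positive. -/
theorem oplus_mem_pos (hm : 0 < m) (hn : 0 < n) {v : Matrix (Fin m) (Fin m) V}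
    {w : Matrix (Fin n) (Fin n) V} (hv : v ∈ S.pos m) (hw : w ∈ S.pos n) :
    oplus v w ∈ S.pos (m + n) := by
  have := S.abs_oplus m m n n hm hm hn hn v w
  rw [S.abs_of_pos hm hv, S.abs_of_pos hn hw] at this
  rw [← this]
  exact S.abs_mem _ _ (by omega) (by omega) _

theorem sub_mem_trans (hn : 0 < n) {u v w : Matrix (Fin n) (Fin n) V} (h : u - v ∈ S.pos n)
    (h' : v - w ∈ S.pos n) : u - w ∈ S.pos n := by
  simpa using S.add_mem n hn _ h _ h'

theorem abs_lmul_rmul_le (hr : 0 < r) (hm : 0 < m) (hn : 0 < n) (hs : 0 < s)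
    {α : Matrix (Fin r) (Fin m) ℂ} (hα : opNorm α ≤ 1) (v : Matrix (Fin m) (Fin n) V)
    (β : Matrix (Fin n) (Fin s) ℂ) :
    S.abs n s (rmul (S.abs m n v) β) - S.abs r s (lmul α (rmul v β)) ∈ S.pos s := by
  refine S.sub_mem_trans hs ?_ (S.abs_mul_le r m n s hr hm hn hs α v β)
  have := S.smul_mem s hs (1 - opNorm α) (by linarith) _
    (S.abs_mem n s hn hs (rmul (S.abs m n v) β))
  simpa [sub_smul] using this

/-- Left multiplication by a scalar isometry does not change the absolute value. -/
theorem abs_lmul (hr : 0 < r) (hm : 0 < m) (hn : 0 < n) {α : Matrix (Fin r) (Fin m) ℂ}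
    (hα : αᴴ * α = 1) (v : Matrix (Fin m) (Fin n) V) : S.abs r n (lmul α v) = S.abs m n v := by
  have le : ∀ {p q : ℕ} (_ : 0 < p) (_ : 0 < q) {γ : Matrix (Fin q) (Fin p) ℂ} (_ : opNorm γ ≤ 1)
      (w : Matrix (Fin p) (Fin n) V), S.abs p n w - S.abs q n (lmul γ w) ∈ S.pos n := by
    intro p q hp hq γ hγ w
    have := S.abs_lmul_rmul_le hq hp hn hn hγ w 1
    rwa [rmul_one, rmul_one, S.abs_of_pos hn (S.abs_mem p n hp hn w)] at this
  have hα' : opNorm αᴴ ≤ 1 := by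
    have : opNorm αᴴ = opNorm α := by
      open scoped Matrix.Norms.L2Operator in
      exact Matrix.l2_opNorm_conjTranspose α
    exact this.trans_le (opNorm_le_one hα)
  refine S.eq_of_sub_mem hn ?_ (le hm hr (opNorm_le_one hα) v)
  -- `αᴴ` undoes `α`, so the same inequality applied to `α v` gives the reverse bound.
  have := le hr hm hα' (lmul α v)
  rwa [lmul_lmul, hα, lmul_one] at this

/-- For a coisometry `β`, the element `|v| β` has absolute value `β* |v| β`. -/
theorem abs_rmul_pos (hn : 0 < n) (hs : 0 < s) {β : Matrix (Fin n) (Fin s) ℂ} (hβ : β * βᴴ = 1)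
    {v : Matrix (Fin n) (Fin n) V} (hv : v ∈ S.pos n) :
    S.abs n s (rmul v β) = lmul βᴴ (rmul v β) := by
  -- `βᴴ` is an isometry, so multiplying by it on the left keeps the absolute value and makes the
  -- element positive.
  rw [← S.abs_lmul hs hn hs (α := βᴴ) (by simpa using hβ),
    S.abs_of_pos hs (S.conj_mem n s hn hs v hv β)]

theorem abs_lmul_rmul_le_conj (hr : 0 < r) (hm : 0 < m) (hn : 0 < n) (hs : 0 < s)
    {α : Matrix (Fin r) (Fin m) ℂ} (hα : αᴴ * α = 1) {β : Matrix (Fin n) (Fin s) ℂ}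
    (hβ : β * βᴴ = 1) (v : Matrix (Fin m) (Fin n) V) :
    lmul βᴴ (rmul (S.abs m n v) β) - S.abs r s (lmul α (rmul v β)) ∈ S.pos s := by
  rw [← S.abs_rmul_pos hn hs hβ (S.abs_mem m n hm hn v)]
  exact S.abs_lmul_rmul_le hr hm hn hs (opNorm_le_one hα) v β

/-- `|α v β| = β* |v| β` for an isometry `α` and a unitary `β`. -/
theorem abs_lmul_rmul (hr : 0 < r) (hm : 0 < m) (hn : 0 < n) (hs : 0 < s)
    {α : Matrix (Fin r) (Fin m) ℂ} (hα : αᴴ * α = 1) {β : Matrix (Fin n) (Fin s) ℂ}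
    (hβ : β * βᴴ = 1) (hβ' : βᴴ * β = 1) (v : Matrix (Fin m) (Fin n) V) :
    S.abs r s (lmul α (rmul v β)) = lmul βᴴ (rmul (S.abs m n v) β) := by
  refine S.eq_of_sub_mem hs ?_ (S.abs_lmul_rmul_le_conj hr hm hn hs hα hβ v)
  rw [S.abs_lmul hr hm hs hα]
  -- Reverse inequality: apply the bound to `v β` with `βᴴ` as right factor, then conjugate the
  -- result by `β`.
  have h := S.abs_lmul_rmul_le_conj hm hm hs hn (α := 1) (by simp) (β := βᴴ) (by simpa using hβ')
    (rmul v β)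
  rw [lmul_one, rmul_rmul, hβ, rmul_one, conjTranspose_conjTranspose] at h
  have h' := S.conj_mem n s hn hs _ h β
  rwa [rmul_sub, lmul_sub, lmul_rmul β, rmul_rmul, hβ', rmul_one, lmul_lmul, hβ', lmul_one] at h'

/-- Relabelling is multiplication by permutation matrices, which are unitary. -/
theorem abs_submatrix (hr : 0 < r) (hm : 0 < m) (hn : 0 < n) (hs : 0 < s) (σ : Fin r ≃ Fin m)
    (τ : Fin s ≃ Fin n) (v : Matrix (Fin m) (Fin n) V) :
    S.abs r s (v.submatrix σ τ) = (S.abs m n v).submatrix τ τ := by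
  rw [submatrix_eq_lmul_rmul v, submatrix_eq_lmul_rmul (S.abs m n v), S.abs_lmul_rmul hr hm hn hs]
  · simp
  · rw [conjTranspose_submatrix, conjTranspose_one, submatrix_mul_equiv]
    simp
  · rw [conjTranspose_submatrix, conjTranspose_one, submatrix_mul_equiv]
    simp
  · rw [conjTranspose_submatrix, conjTranspose_one,
      ← submatrix_mul (1 : Matrix (Fin n) (Fin n) ℂ) (1 : Matrix (Fin n) (Fin n) ℂ) τ id τ
        Function.bijective_id]
    simp

/-- Homogeneity is an axiom only for self-adjoint square matrices; here the factor `‖α‖` with `α =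
0` bounds the absolute value by zero. -/
theorem abs_zero (hm : 0 < m) (hn : 0 < n) : S.abs m n 0 = 0 := by
  have h := S.abs_mul_le m m n n hm hm hn hn 0 0 1
  have h0 : lmul (0 : Matrix (Fin m) (Fin m) ℂ) (rmul (0 : Matrix (Fin m) (Fin n) V)
      (1 : Matrix (Fin n) (Fin n) ℂ)) = 0 := by
    ext i j
    simp [lmul]
  have h1 : opNorm (0 : Matrix (Fin m) (Fin m) ℂ) = 0 := by
    open scoped Matrix.Norms.L2Operator in
    exact norm_zero
  rw [h0, h1] at h
  exact S.eq_zero_of_mem_of_neg_mem hn (S.abs_mem m n hm hn 0) (by simpa using h)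

/-- The absolute value of the self-adjoint dilation of `v`. -/
theorem abs_dilation (hn : 0 < n) (v : Matrix (Fin n) (Fin n) V) :
    S.abs (n + n) (n + n) (block 0 v vᴴ 0) = oplus (S.abs n n vᴴ) (S.abs n n v) := by
  rw [block_zero_diag, ← Equiv.coe_refl, S.abs_submatrix (by omega) (by omega) (by omega) (by omega),
    S.abs_oplus n n n n hn hn hn hn, oplus_swap]

/-- `|2p - eⁿ| + (2p - eⁿ)` is positive and equals `2p`. -/
theorem mem_pos_of_mem_OP (hn : 0 < n) {p : Matrix (Fin n) (Fin n) V} (hp : p ∈ S.OP n) :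
    p ∈ S.pos n := by
  have hH : ((2 : ℂ) • p - unitMat S.e n).IsHermitian := by
    refine IsHermitian.sub ?_ (S.isHermitian_unitMat hn)
    rw [two_smul]
    exact IsHermitian.add hp.1 hp.1
  have h := (S.isAbsolutelyOrdered n hn).abs_add_mem _ hH
  rw [hp.2, add_sub_cancel] at h
  have := S.smul_mem n hn (1 / 2) (by norm_num) _ h
  rw [smul_smul] at this
  simpa using this

/-- The complement is again an order projection, because `2(eⁿ - p) - eⁿ = -(2p - eⁿ)`. -/
theorem unit_sub_mem_pos_of_mem_OP (hn : 0 < n) {p : Matrix (Fin n) (Fin n) V} (hp : p ∈ S.OP n) :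
    unitMat S.e n - p ∈ S.pos n := by
  refine S.mem_pos_of_mem_OP hn ⟨(S.isHermitian_unitMat hn).sub hp.1, ?_⟩
  have hH : ((2 : ℂ) • p - unitMat S.e n).IsHermitian := by
    refine IsHermitian.sub ?_ (S.isHermitian_unitMat hn)
    rw [two_smul]
    exact IsHermitian.add hp.1 hp.1
  have := (S.isAbsolutelyOrdered n hn).abs_smul _ hH (-1)
  rw [hp.2] at this
  simp only [Complex.ofReal_neg, Complex.ofReal_one, neg_smul, one_smul, abs_neg, abs_one] at this
  convert this using 2
  rw [two_smul, two_smul]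
  abel

/-! ### Scalar unitary conjugation -/

variable {α : Matrix (Fin n) (Fin n) ℂ}

theorem abs_conj (hn : 0 < n) (hα : αᴴ * α = 1) (v : Matrix (Fin n) (Fin n) V) :
    S.abs n n (lmul α (rmul v αᴴ)) = lmul α (rmul (S.abs n n v) αᴴ) := by
  have hα' : α * αᴴ = 1 := mul_eq_one_comm.1 hα
  simpa using S.abs_lmul_rmul hn hn hn hn hα (β := αᴴ) (by simpa using hα) (by simpa using hα') v

theorem conj_unitMat (hα : αᴴ * α = 1) :
    lmul α (rmul (unitMat S.e n) αᴴ) = unitMat S.e n :=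
  lmul_rmul_unitMat_of_mul_eq_one _ (mul_eq_one_comm.1 hα)

end AbsMatrixOrderUnitSpace

/-! ### Completing a partial unitary; invariance under scalar unitaries. -/

variable [StarModule ℂ V]

namespace AbsMatrixOrderUnitSpace

variable (S : AbsMatrixOrderUnitSpace V)

theorem abs_add_of_perp (hn : 0 < n) {u v : Matrix (Fin n) (Fin n) V} (hu : u.IsHermitian)
    (hv : v.IsHermitian)
    (h : S.abs n n (S.abs n n u - S.abs n n v) = S.abs n n u + S.abs n n v) :
    S.abs n n (u + v) = S.abs n n u + S.abs n n v := by
  refine (S.isAbsolutelyOrdered n hn).abs_add_of_perp (fun x hx y hy => IsHermitian.add hx hy)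
    (fun x hx k => ?_) (S.isHermitian_of_mem n hn) (S.add_mem n hn)
    (fun x hx k hk => S.smul_mem n hn k hk x hx) hu hv h
  change ((k : ℂ) • x)ᴴ = (k : ℂ) • x
  rw [conjTranspose_smul, hx]
  simp

/-- A partial unitary, completed by the complement of its absolute value, is unitary. -/
theorem add_unit_sub_abs_mem_U (hn : 0 < n) {u : Matrix (Fin n) (Fin n) V} (hu : u ∈ S.PU n) :
    u + unitMat S.e n - S.abs n n u ∈ S.U n := by
  set p := S.abs n n u with hp
  have hup : S.abs n n uᴴ = p := hu.1.symm
  set w := unitMat S.e n - p with hw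
  have hwpos : w ∈ S.pos n := S.unit_sub_mem_pos_of_mem_OP hn hu.2
  have hwH : wᴴ = w := S.isHermitian_of_mem n hn w hwpos
  -- The defining equation of an order projection says precisely that `p` is orthogonal to its
  -- complement.
  have hpw : S.abs n n (p - w) = p + w := by
    have := hu.2.2
    rw [← hp] at this
    rw [hw, add_sub_cancel]
    convert this using 2
    rw [two_smul]
    abel
  have hN : 0 < n + n := by omega
  -- Dilating makes both summands self-adjoint; the two diagonal corners of the resulting identity
  -- give `|(u + w)*|` and `|u + w|`.
  have key := S.abs_add_of_perp hN (isHermitian_dilation u) (isHermitian_dilation w) (by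
    rw [S.abs_dilation hn, S.abs_dilation hn, hwH, hup, ← hp, S.abs_of_pos hn hwpos, oplus_sub_oplus,
      S.abs_oplus n n n n hn hn hn hn, hpw, oplus_add_oplus])
  rw [block_add_block, add_zero, ← conjTranspose_add, S.abs_dilation hn, S.abs_dilation hn,
    S.abs_dilation hn, hwH, hup, ← hp, S.abs_of_pos hn hwpos, oplus_add_oplus] at key
  obtain ⟨h₁, h₂⟩ := oplus_inj key
  have he : u + unitMat S.e n - p = u + w := by rw [hw]; abel
  have hpe : p + w = unitMat S.e n := by rw [hw]; abel
  rw [he]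
  exact ⟨h₂.trans hpe, h₁.trans hpe⟩

variable {α : Matrix (Fin n) (Fin n) ℂ}

theorem conjTranspose_conj (v : Matrix (Fin n) (Fin n) V) :
    (lmul α (rmul v αᴴ))ᴴ = lmul α (rmul vᴴ αᴴ) := by
  rw [conjTranspose_lmul, conjTranspose_rmul, conjTranspose_conjTranspose, lmul_rmul]

theorem conj_mem_OP (hn : 0 < n) (hα : αᴴ * α = 1) {p : Matrix (Fin n) (Fin n) V}
    (hp : p ∈ S.OP n) : lmul α (rmul p αᴴ) ∈ S.OP n := by
  refine ⟨by rw [conjTranspose_conj, hp.1], ?_⟩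
  have : (2 : ℂ) • lmul α (rmul p αᴴ) - unitMat S.e n =
      lmul α (rmul ((2 : ℂ) • p - unitMat S.e n) αᴴ) := by
    rw [rmul_sub, lmul_sub, S.conj_unitMat hα, rmul_smul, lmul_smul]
  rw [this, S.abs_conj hn hα, hp.2, S.conj_unitMat hα]

theorem conj_mem_U (hn : 0 < n) (hα : αᴴ * α = 1) {u : Matrix (Fin n) (Fin n) V}
    (hu : u ∈ S.U n) : lmul α (rmul u αᴴ) ∈ S.U n := by
  constructor
  · rw [S.abs_conj hn hα, hu.1, S.conj_unitMat hα]
  · rw [conjTranspose_conj, S.abs_conj hn hα, hu.2, S.conj_unitMat hα]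

theorem conj_mem_PU (hn : 0 < n) (hα : αᴴ * α = 1) {u : Matrix (Fin n) (Fin n) V}
    (hu : u ∈ S.PU n) : lmul α (rmul u αᴴ) ∈ S.PU n := by
  constructor
  · rw [conjTranspose_conj, S.abs_conj hn hα, S.abs_conj hn hα, hu.1]
  · rw [S.abs_conj hn hα]
    exact S.conj_mem_OP hn hα hu.2

end AbsMatrixOrderUnitSpace

end AMOU

/-! ### The matrix norm as a seminorm, and continuous paths. -/

namespace AMOU

variable {V : Type*} [AddCommGroup V] [Module ℂ V] [StarAddMonoid V] [StarModule ℂ V] {m n : ℕ}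

namespace AbsMatrixOrderUnitSpace

variable (S : AbsMatrixOrderUnitSpace V)

/-- `[k eⁿ, v; v*, k eⁿ] ≥ 0`, the condition which bounds the norm of `v` by `k`. -/
def NormBound (k : ℝ) (v : Matrix (Fin n) (Fin n) V) : Prop :=
  block ((k : ℂ) • unitMat S.e n) v vᴴ ((k : ℂ) • unitMat S.e n) ∈ S.pos (n + n)

variable {S}

theorem NormBound.add (hn : 0 < n) {k k' : ℝ} {v w : Matrix (Fin n) (Fin n) V}
    (h : S.NormBound k v) (h' : S.NormBound k' w) : S.NormBound (k + k') (v + w) := by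
  have := S.add_mem (n + n) (by omega) _ h _ h'
  rw [block_add_block, ← add_smul, ← conjTranspose_add] at this
  simpa [NormBound] using this

theorem normBound_zero (hn : 0 < n) {k : ℝ} (hk : 0 ≤ k) :
    S.NormBound k (0 : Matrix (Fin n) (Fin n) V) := by
  have h := S.smul_mem n hn k hk _ (S.unit_mem_pos hn)
  have := S.oplus_mem_pos hn hn h h
  simpa [NormBound, oplus] using this

theorem NormBound.mono (hn : 0 < n) {k k' : ℝ} {v : Matrix (Fin n) (Fin n) V}
    (h : S.NormBound k v) (hk : k ≤ k') : S.NormBound k' v := by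
  simpa using h.add hn (normBound_zero hn (sub_nonneg.2 hk))

/-- With `t = √‖c‖`, conjugation by the scalars `c̄ / t` and `t` on the two blocks multiplies both
diagonal blocks by `t² = ‖c‖` and the upper corner by `(c / t) t = c`. -/
theorem NormBound.smul (hn : 0 < n) {k : ℝ} {v : Matrix (Fin n) (Fin n) V}
    (h : S.NormBound k v) (c : ℂ) : S.NormBound (‖c‖ * k) (c • v) := by
  rcases eq_or_ne c 0 with rfl | hc
  · simpa using normBound_zero hn le_rfl
  set t : ℂ := (Real.sqrt ‖c‖ : ℂ) with ht
  have htt : t * t = (‖c‖ : ℂ) := by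
    rw [ht, ← Complex.ofReal_mul, Real.mul_self_sqrt (norm_nonneg c)]
  have htne : t ≠ 0 := by
    intro h0
    rw [h0, mul_zero] at htt
    exact hc (norm_eq_zero.1 (by exact_mod_cast htt.symm))
  have hts : star t = t := by simp [ht]
  -- conjugation by `diag (d i)`, with `d = star c / t` on the first block and `d = t` on the second
  let d : Fin (n + n) → ℂ := Fin.append (fun _ : Fin n => star c / t) (fun _ : Fin n => t)
  have hd : ∀ v : Matrix (Fin (n + n)) (Fin (n + n)) V,
      lmul (diagonal d)ᴴ (rmul v (diagonal d)) = of fun i j => (star (d i) * d j) • v i j := by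
    intro v
    ext i j
    simp [lmul, rmul, diagonal_apply, mul_smul, apply_ite (starRingEnd ℂ)]
  have h₁ := S.conj_mem (n + n) (n + n) (by omega) (by omega) _ h (diagonal d)
  rw [hd] at h₁
  have hcc : c * star c = t * t * (t * t) := by
    rw [htt]
    have := Complex.mul_conj' c
    rw [← sq]
    exact this
  rw [NormBound]
  convert h₁ using 1
  ext i j
  have e₁ : c / t * (star c / t) = t * t := by
    field_simp
    rw [hcc]; ring
  refine Fin.addCases (fun i => ?_) (fun i => ?_) i <;>
    refine Fin.addCases (fun j => ?_) (fun j => ?_) j <;>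
    simp only [block, reindex_apply, submatrix_apply, of_apply, d, Fin.append_left, Fin.append_right,
      finSumFinEquiv_symm_apply_castAdd, finSumFinEquiv_symm_apply_natAdd, fromBlocks_apply₁₁,
      fromBlocks_apply₁₂, fromBlocks_apply₂₁, fromBlocks_apply₂₂, Matrix.smul_apply, smul_smul,
      Complex.ofReal_mul, ← htt, star_div₀, star_star, hts, conjTranspose_smul]
  · rw [e₁]
  · congr 1
    field_simp
  · congr 1
    field_simp

theorem NormBound.oplus (hm : 0 < m) (hn : 0 < n) {k : ℝ} {v : Matrix (Fin m) (Fin m) V}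
    {w : Matrix (Fin n) (Fin n) V} (h : S.NormBound k v) (h' : S.NormBound k w) :
    S.NormBound k (oplus v w) := by
  have h₁ := S.oplus_mem_pos (by omega) (by omega) h h'
  obtain ⟨σ, hσ⟩ := permEq_oplus_block ((k : ℂ) • unitMat S.e m) v vᴴ ((k : ℂ) • unitMat S.e n) w wᴴ
  rw [NormBound, ← oplus_unitMat, smul_oplus, conjTranspose_oplus, hσ]
  exact S.submatrix_mem (by omega) (by omega) h₁ σ

/-- For the dilation `D` of `v`, the two positive elements `k e - |D|` and `|D| + D` add up to `k e
+ D`. -/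
theorem normBound_of_abs_le (hn : 0 < n) {k : ℝ} {v : Matrix (Fin n) (Fin n) V}
    (h : (k : ℂ) • unitMat S.e n - S.abs n n v ∈ S.pos n)
    (h' : (k : ℂ) • unitMat S.e n - S.abs n n vᴴ ∈ S.pos n) : S.NormBound k v := by
  have h₁ := S.oplus_mem_pos hn hn h' h
  rw [← oplus_sub_oplus, ← S.abs_dilation hn] at h₁
  have h₂ := (S.isAbsolutelyOrdered (n + n) (by omega)).abs_add_mem _ (isHermitian_dilation v)
  have h₃ := S.add_mem (n + n) (by omega) _ h₁ _ h₂
  rwa [add_comm (S.abs _ _ _), sub_add_add_cancel, AMOU.oplus, block_add_block, add_zero,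
    zero_add, zero_add] at h₃

/-- A matrix with a single entry is `α y β` with `y` of size one, `α` an isometry and `β` a
coisometry. Hence its absolute value is at most `βᴴ |y| β ≤ k βᴴ e β ≤ k eⁿ`. -/
theorem abs_single_le (hn : 0 < n) (i j : Fin n) (x : V) :
    ∃ k : ℝ, 0 < k ∧ (k : ℂ) • unitMat S.e n - S.abs n n (Matrix.single i j x) ∈ S.pos n := by
  let y : Matrix (Fin 1) (Fin 1) V := of fun _ _ => x
  have hy := S.abs_mem 1 1 one_pos one_pos y
  obtain ⟨k, hk, -, hk'⟩ := S.orderUnit _ (S.isHermitian_of_mem 1 one_pos _ hy)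
  refine ⟨k, hk, ?_⟩
  let α : Matrix (Fin n) (Fin 1) ℂ := of fun a _ => if a = i then 1 else 0
  let β : Matrix (Fin 1) (Fin n) ℂ := of fun _ b => if b = j then 1 else 0
  have hα : αᴴ * α = 1 := by
    ext a b
    simp [α, Matrix.mul_apply, Matrix.one_apply, Subsingleton.elim a b]
  have hβ : β * βᴴ = 1 := by
    ext a b
    simp [β, Matrix.mul_apply, Matrix.one_apply, Subsingleton.elim a b]
  have hs : Matrix.single i j x = lmul α (rmul y β) := by
    ext a b
    simp only [α, β, y, lmul, rmul, Matrix.single_apply, Finset.univ_unique, Finset.sum_singleton,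
      of_apply, ite_smul, one_smul, zero_smul, ← ite_and, eq_comm]
  have h₁ := S.abs_lmul_rmul_le_conj hn one_pos one_pos hn hα hβ y
  have h₂ := S.conj_mem 1 n one_pos hn _ hk' β
  rw [rmul_sub, lmul_sub, rmul_smul, lmul_smul] at h₂
  -- the complementary diagonal projection
  let γ : Matrix (Fin n) (Fin n) ℂ := diagonal fun a => if a = j then 0 else 1
  have h₃ := S.smul_mem n hn k hk.le _ (S.conj_mem n n hn hn _ (S.unit_mem_pos hn) γ)
  have h₄ : lmul γᴴ (rmul (unitMat S.e n) γ) + lmul βᴴ (rmul (unitMat S.e 1) β) = unitMat S.e n := by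
    rw [lmul_rmul_unitMat, lmul_rmul_unitMat]
    ext a b
    by_cases hab : a = b
    · subst hab
      by_cases ha : a = j <;> simp [γ, β, unitMat, Matrix.mul_apply, diagonal_apply, ha]
    · by_cases ha : a = j
      · have hb : b ≠ j := fun hb => hab (ha.trans hb.symm)
        simp [γ, β, unitMat, Matrix.mul_apply, diagonal_apply, ha, hb, hb.symm]
      · simp [γ, β, unitMat, Matrix.mul_apply, diagonal_apply, ha, hab]
  rw [hs]
  refine S.sub_mem_trans hn ?_ h₁
  have h₅ := S.add_mem n hn _ h₃ _ h₂
  rwa [← add_sub_assoc, ← smul_add, h₄] at h₅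

/-- The infimum defining the norm is taken over a nonempty set; without this the default value `sInf
∅ = 0` would make it meaningless. -/
theorem exists_normBound (hn : 0 < n) (v : Matrix (Fin n) (Fin n) V) :
    ∃ k : ℝ, 0 < k ∧ S.NormBound k v := by
  refine Matrix.induction_on' v ⟨1, one_pos, normBound_zero hn zero_le_one⟩ ?_ ?_
  · rintro p q ⟨k, hk, h⟩ ⟨k', hk', h'⟩
    exact ⟨k + k', add_pos hk hk', h.add hn h'⟩
  · intro i j x
    obtain ⟨k, hk, h⟩ := abs_single_le (S := S) hn i j x
    obtain ⟨k', hk', h'⟩ := abs_single_le (S := S) hn j i (star x)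
    have up : ∀ {a b : ℝ} {w : Matrix (Fin n) (Fin n) V}, a ≤ b →
        (a : ℂ) • unitMat S.e n - w ∈ S.pos n → (b : ℂ) • unitMat S.e n - w ∈ S.pos n := by
      intro a b w hab hw
      have := S.add_mem n hn _ (S.smul_mem n hn (b - a) (by linarith) _ (S.unit_mem_pos hn)) _ hw
      rw [← add_sub_assoc, ← add_smul] at this
      simpa using this
    refine ⟨max k k', lt_max_of_lt_left hk, normBound_of_abs_le hn (up (le_max_left _ _) h) ?_⟩
    rw [conjTranspose_single]
    exact up (le_max_right _ _) h'

theorem mnorm_le {k : ℝ} (hk : 0 < k) {v : Matrix (Fin n) (Fin n) V} (h : S.NormBound k v) :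
    S.mnorm v ≤ k := csInf_le ⟨0, fun _ hx => hx.1.le⟩ ⟨hk, h⟩

theorem normBound_of_mnorm_lt (hn : 0 < n) {k : ℝ} {v : Matrix (Fin n) (Fin n) V}
    (h : S.mnorm v < k) : S.NormBound k v := by
  obtain ⟨k', ⟨-, h'⟩, hlt⟩ := exists_lt_of_csInf_lt (exists_normBound (S := S) hn v) h
  exact NormBound.mono hn h' hlt.le

theorem mnorm_nonneg (v : Matrix (Fin n) (Fin n) V) : 0 ≤ S.mnorm v :=
  Real.sInf_nonneg fun _ hx => hx.1.le

theorem mnorm_le_of_forall {c : ℝ} (hc : 0 ≤ c) {v : Matrix (Fin n) (Fin n) V}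
    (h : ∀ k, c < k → S.NormBound k v) : S.mnorm v ≤ c :=
  le_of_forall_gt_imp_ge_of_dense fun k hk => mnorm_le (hc.trans_lt hk) (h k hk)

theorem mnorm_add_le (hn : 0 < n) (v w : Matrix (Fin n) (Fin n) V) :
    S.mnorm (v + w) ≤ S.mnorm v + S.mnorm w := by
  refine mnorm_le_of_forall (add_nonneg (mnorm_nonneg v) (mnorm_nonneg w)) fun k hk => ?_
  -- The slack between `k` and the sum of the norms is shared equally.
  have h₁ := normBound_of_mnorm_lt hn (S := S) (v := v)
    (k := S.mnorm v + (k - (S.mnorm v + S.mnorm w)) / 2) (by linarith)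
  have h₂ := normBound_of_mnorm_lt hn (S := S) (v := w)
    (k := S.mnorm w + (k - (S.mnorm v + S.mnorm w)) / 2) (by linarith)
  convert h₁.add hn h₂ using 1
  ring

theorem mnorm_smul_le (hn : 0 < n) (c : ℂ) (v : Matrix (Fin n) (Fin n) V) :
    S.mnorm (c • v) ≤ ‖c‖ * S.mnorm v := by
  refine mnorm_le_of_forall (mul_nonneg (norm_nonneg c) (mnorm_nonneg v)) fun k hk => ?_
  rcases eq_or_ne c 0 with rfl | hc
  · simpa using normBound_zero hn (by simpa using hk.le)
  have hc' : 0 < ‖c‖ := norm_pos_iff.2 hc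
  have := (normBound_of_mnorm_lt hn (S := S) (v := v) (k := k / ‖c‖)
    (by rwa [lt_div_iff₀' hc'])).smul hn c
  rwa [mul_div_cancel₀ _ hc'.ne'] at this

theorem mnorm_zero (hn : 0 < n) : S.mnorm (0 : Matrix (Fin n) (Fin n) V) = 0 :=
  le_antisymm (mnorm_le_of_forall le_rfl fun _ hk => normBound_zero hn hk.le) (mnorm_nonneg _)

theorem mnorm_oplus_zero_le (hm : 0 < m) (hn : 0 < n) (v : Matrix (Fin m) (Fin m) V) :
    S.mnorm (oplus v (0 : Matrix (Fin n) (Fin n) V)) ≤ S.mnorm v :=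
  mnorm_le_of_forall (mnorm_nonneg v) fun _ hk =>
    (normBound_of_mnorm_lt hm hk).oplus hm hn (normBound_zero hn ((mnorm_nonneg v).trans hk.le))

variable (S)

/-- The matrix norm as a seminorm. -/
noncomputable def mseminorm (hn : 0 < n) : Seminorm ℂ (Matrix (Fin n) (Fin n) V) :=
  Seminorm.ofSMulLE S.mnorm (mnorm_zero hn) (mnorm_add_le hn) (mnorm_smul_le hn)

/-- `M_n(V)` as a seminormed group. -/
noncomputable abbrev seminormedGroup (hn : 0 < n) :
    SeminormedAddCommGroup (Matrix (Fin n) (Fin n) V) :=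
  (S.mseminorm hn).toAddGroupSeminorm.toSeminormedAddCommGroup

/-- Continuity of a map `M_m(V) → M_n(V)` for the matrix norms. -/
def MContinuous (F : Matrix (Fin m) (Fin m) V → Matrix (Fin n) (Fin n) V) : Prop :=
  ∀ v, ∀ ε : ℝ, 0 < ε → ∃ δ : ℝ, 0 < δ ∧ ∀ w, S.mnorm (w - v) < δ → S.mnorm (F w - F v) < ε

variable {S}

/-- Reversal and concatenation of paths become available once the norm is installed as a local
topology; separation is not needed for this. -/
theorem homotopic_iff_joinedIn (hn : 0 < n) {A : Set (Matrix (Fin n) (Fin n) V)}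
    {u v : Matrix (Fin n) (Fin n) V} :
    S.Homotopic A u v ↔ letI := S.seminormedGroup hn; JoinedIn A u v := by
  let _ := S.seminormedGroup hn
  have key : ∀ f : unitInterval → Matrix (Fin n) (Fin n) V, Continuous f ↔
      ∀ t, ∀ ε : ℝ, 0 < ε → ∃ δ : ℝ, 0 < δ ∧ ∀ s, dist s t < δ → S.mnorm (f s - f t) < ε := by
    intro f
    rw [Metric.continuous_iff]
    refine forall_congr' fun t => forall_congr' fun ε => forall_congr' fun _ =>
      exists_congr fun δ => and_congr_right fun _ => forall_congr' fun s => ?_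
    rw [dist_eq_norm]
    rfl
  constructor
  · rintro ⟨f, hA, hc, h0, h1⟩
    exact ⟨⟨⟨f, (key f).2 hc⟩, h0, h1⟩, hA⟩
  · rintro ⟨γ, hA⟩
    exact ⟨γ, hA, (key γ).1 γ.continuous, γ.source, γ.target⟩

section homotopic

variable {A : Set (Matrix (Fin n) (Fin n) V)} {u v w : Matrix (Fin n) (Fin n) V}

theorem homotopic_refl (hn : 0 < n) (h : u ∈ A) : S.Homotopic A u u :=
  (homotopic_iff_joinedIn hn).2 (letI := S.seminormedGroup hn; JoinedIn.refl h)

theorem homotopic_symm (hn : 0 < n) (h : S.Homotopic A u v) : S.Homotopic A v u :=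
  (homotopic_iff_joinedIn hn).2
    (letI := S.seminormedGroup hn; JoinedIn.symm ((homotopic_iff_joinedIn hn).1 h))

theorem homotopic_trans (hn : 0 < n) (h : S.Homotopic A u v) (h' : S.Homotopic A v w) :
    S.Homotopic A u w :=
  (homotopic_iff_joinedIn hn).2 (letI := S.seminormedGroup hn
    JoinedIn.trans ((homotopic_iff_joinedIn hn).1 h) ((homotopic_iff_joinedIn hn).1 h'))

theorem homotopic_map {B : Set (Matrix (Fin m) (Fin m) V)}
    {F : Matrix (Fin n) (Fin n) V → Matrix (Fin m) (Fin m) V} (hF : S.MContinuous F)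
    (hAB : ∀ x ∈ A, F x ∈ B) (h : S.Homotopic A u v) : S.Homotopic B (F u) (F v) := by
  obtain ⟨f, hA, hc, rfl, rfl⟩ := h
  refine ⟨F ∘ f, fun t => hAB _ (hA t), fun t ε hε => ?_, rfl, rfl⟩
  obtain ⟨δ, hδ, h⟩ := hF (f t) ε hε
  obtain ⟨η, hη, h'⟩ := hc t δ hδ
  exact ⟨η, hη, fun s hs => h _ (h' s hs)⟩

end homotopic

theorem mContinuous_oplus_right (hm : 0 < m) (hn : 0 < n) (w : Matrix (Fin n) (Fin n) V) :
    S.MContinuous fun v : Matrix (Fin m) (Fin m) V => oplus v w := by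
  refine fun v ε hε => ⟨ε, hε, fun v' h => lt_of_le_of_lt ?_ h⟩
  rw [oplus_sub_oplus, sub_self]
  exact mnorm_oplus_zero_le hm hn _

theorem mContinuous_add_sub_abs (hn : 0 < n) (h : S.AbsContinuous n) :
    S.MContinuous fun v : Matrix (Fin n) (Fin n) V => v + unitMat S.e n - S.abs n n v := by
  intro v ε hε
  obtain ⟨δ, hδ, h'⟩ := h v (ε / 2) (half_pos hε)
  refine ⟨min δ (ε / 2), lt_min hδ (half_pos hε), fun w hw => ?_⟩
  have e : w + unitMat S.e n - S.abs n n w - (v + unitMat S.e n - S.abs n n v) =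
      (w - v) + (-1 : ℂ) • (S.abs n n w - S.abs n n v) := by
    rw [neg_one_smul]; abel
  have h₁ := h' w (hw.trans_le (min_le_left _ _))
  have h₂ := hw.trans_le (min_le_right _ _)
  have h₃ := mnorm_smul_le (S := S) hn (-1) (S.abs n n w - S.abs n n v)
  rw [norm_neg, norm_one, one_mul] at h₃
  rw [e]
  linarith [mnorm_add_le (S := S) hn (w - v) ((-1 : ℂ) • (S.abs n n w - S.abs n n v))]

/-! ### Permutations are connected to the identity -/

/-- A transposition matrix `s` is a self-adjoint unitary. The path `(1 + s)/2 + z (1 - s)/2` with `z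
= exp(iπt)` consists of unitaries and runs from `1` to `s`; conjugating `v` along it stays in `A`.
-/
theorem homotopic_submatrix_swap (hn : 0 < n) {A : Set (Matrix (Fin n) (Fin n) V)}
    (hA : ∀ α : Matrix (Fin n) (Fin n) ℂ, αᴴ * α = 1 → ∀ v ∈ A, lmul α (rmul v αᴴ) ∈ A)
    {v : Matrix (Fin n) (Fin n) V} (hv : v ∈ A) (i j : Fin n) :
    S.Homotopic A v (v.submatrix (Equiv.swap i j) (Equiv.swap i j)) := by
  set s : Matrix (Fin n) (Fin n) ℂ := (1 : Matrix (Fin n) (Fin n) ℂ).submatrix (Equiv.swap i j) id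
    with hs
  have hsH : sᴴ = s := by
    ext a b
    simp only [hs, conjTranspose_apply, submatrix_apply, id, Matrix.one_apply, apply_ite star,
      star_one, star_zero]
    congr 1
    rw [eq_iff_iff, Equiv.swap_apply_eq_iff, eq_comm]
  have hss : s * s = 1 := by
    have : s * s = sᴴ * s := by rw [hsH]
    rw [this, hs, conjTranspose_submatrix, conjTranspose_one, submatrix_mul_equiv]
    simp
  have hvs : v.submatrix (Equiv.swap i j) (Equiv.swap i j) = lmul s (rmul v s) := by
    rw [submatrix_eq_lmul_rmul, ← hs]
    congr 2
    rw [← hsH, hs, conjTranspose_submatrix, conjTranspose_one]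
  let z : unitInterval → ℂ := fun t => Complex.exp (Real.pi * (t : ℝ) * Complex.I)
  have hz : Continuous z := by fun_prop
  have hzz : ∀ t, star (z t) * z t = 1 := by
    intro t
    have h := Complex.conj_mul' (z t)
    have h1 : ‖z t‖ = 1 := by
      have := Complex.norm_exp_ofReal_mul_I (Real.pi * (t : ℝ))
      push_cast at this
      exact this
    rw [h1] at h
    simpa using h
  let c : unitInterval → ℂ := fun t => (1 + z t) / 2
  let d : unitInterval → ℂ := fun t => (1 - z t) / 2
  let α : unitInterval → Matrix (Fin n) (Fin n) ℂ := fun t => c t • 1 + d t • s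
  have hαH : ∀ t, (α t)ᴴ = star (c t) • (1 : Matrix (Fin n) (Fin n) ℂ) + star (d t) • s := by
    intro t
    simp only [α, conjTranspose_add, conjTranspose_smul, conjTranspose_one, hsH]
  have hα : ∀ t, (α t)ᴴ * α t = 1 := by
    intro t
    have e₁ : star (c t) * c t + star (d t) * d t = 1 := by
      simp only [c, d, star_div₀, star_add, star_sub, star_one, star_ofNat]
      linear_combination (1 / 2) * hzz t
    have e₂ : star (c t) * d t + star (d t) * c t = 0 := by
      simp only [c, d, star_div₀, star_add, star_sub, star_one, star_ofNat]
      linear_combination (-1 / 2) * hzz t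
    rw [hαH]
    simp only [α, add_mul, mul_add, smul_mul_smul_comm, one_mul, mul_one, hss]
    calc _ = (star (c t) * c t + star (d t) * d t) • (1 : Matrix (Fin n) (Fin n) ℂ) +
          (star (c t) * d t + star (d t) * c t) • s := by module
      _ = 1 := by rw [e₁, e₂, one_smul, zero_smul, add_zero]
  -- Expanded, the path combines four fixed matrices with scalar coefficients, so its continuity is
  -- that of the coefficients.
  have hform : ∀ t, lmul (α t) (rmul v (α t)ᴴ) = (c t * star (c t)) • v +
      (c t * star (d t)) • rmul v s + (d t * star (c t)) • lmul s v +
      (d t * star (d t)) • lmul s (rmul v s) := by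
    intro t
    rw [hαH]
    simp only [α, lmul_add_left, lmul_smul_left, rmul_add_right, rmul_smul_right, lmul_one, rmul_one,
      lmul_add, lmul_smul]
    module
  rw [homotopic_iff_joinedIn hn]
  let _ := S.seminormedGroup hn
  let _ : NormedSpace ℂ (Matrix (Fin n) (Fin n) V) := ⟨fun c x => mnorm_smul_le hn c x⟩
  refine ⟨⟨⟨fun t => lmul (α t) (rmul v (α t)ᴴ), ?_⟩, ?_, ?_⟩, fun t => hA _ (hα t) v hv⟩
  · simp only [hform, c, d]
    fun_prop
  · simp [hform, c, d, z]
  · have : z 1 = -1 := by simp [z, Complex.exp_pi_mul_I]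
    simp [hform, c, d, this, hvs]

/-- Permutations are products of transpositions. -/
theorem homotopic_of_permEq (hn : 0 < n) {A : Set (Matrix (Fin n) (Fin n) V)}
    (hA : ∀ α : Matrix (Fin n) (Fin n) ℂ, αᴴ * α = 1 → ∀ v ∈ A, lmul α (rmul v αᴴ) ∈ A)
    {v w : Matrix (Fin n) (Fin n) V} (hv : v ∈ A) (h : PermEq v w) : S.Homotopic A v w := by
  obtain ⟨σ, rfl⟩ := h
  have mem : ∀ {x y}, S.Homotopic A x y → y ∈ A := by
    rintro x y ⟨f, hf, -, -, rfl⟩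
    exact hf 1
  refine Equiv.Perm.swap_induction_on
    (motive := fun σ => ∀ v ∈ A, S.Homotopic A v (v.submatrix σ σ)) σ
    (fun v hv => homotopic_refl hn hv) ?_ v hv
  intro f i j _ ih v hv
  have h := homotopic_submatrix_swap (S := S) hn hA hv i j
  exact homotopic_trans hn h (ih _ (mem h))

end AbsMatrixOrderUnitSpace

end AMOU

namespace AMOU

/-! ### Group completion of a commutative semigroup up to equivalence -/

/-- `add` is an associative and commutative operation, up to the equivalence relation `Sim`. -/
structure IsCommSemigroupUpTo {X : Type*} (add : X → X → X) (Sim : X → X → Prop) : Prop where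
  equiv : Equivalence Sim
  congr_left : ∀ {x x' : X} (y : X), Sim x x' → Sim (add x y) (add x' y)
  comm : ∀ x y : X, Sim (add x y) (add y x)
  assoc : ∀ x y z : X, Sim (add (add x y) z) (add x (add y z))

/-- The relation on pairs which defines the group completion. -/
def CompletionRel {X : Type*} (add : X → X → X) (Sim : X → X → Prop) (x y : X × X) : Prop :=
  ∃ z, Sim (add (add x.1 y.2) z) (add (add y.1 x.2) z)

namespace IsCommSemigroupUpTo

variable {X : Type*} {add : X → X → X} {Sim : X → X → Prop}

theorem congr (h : IsCommSemigroupUpTo add Sim) {x x' y y' : X} (hx : Sim x x') (hy : Sim y y') :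
    Sim (add x y) (add x' y') :=
  h.equiv.trans (h.congr_left y hx)
    (h.equiv.trans (h.comm _ _) (h.equiv.trans (h.congr_left x' hy) (h.comm _ _)))

/-- The quotient of `X` by `Sim`. -/
def Classes (h : IsCommSemigroupUpTo add Sim) : Type _ := Quotient ⟨Sim, h.equiv⟩

/-- The class of an element. -/
def cls (h : IsCommSemigroupUpTo add Sim) (x : X) : h.Classes := Quotient.mk ⟨Sim, h.equiv⟩ x

theorem cls_eq_iff (h : IsCommSemigroupUpTo add Sim) {x y : X} : h.cls x = h.cls y ↔ Sim x y :=
  Quotient.eq (r := ⟨Sim, h.equiv⟩)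

/-- On classes, identities up to `Sim` become equations that `ac_rfl` settles. -/
instance (h : IsCommSemigroupUpTo add Sim) : AddCommSemigroup h.Classes where
  add := Quotient.map₂ add fun _ _ hx _ _ hy => h.congr hx hy
  add_assoc := by
    rintro ⟨x⟩ ⟨y⟩ ⟨z⟩
    exact h.cls_eq_iff.2 (h.assoc x y z)
  add_comm := by
    rintro ⟨x⟩ ⟨y⟩
    exact h.cls_eq_iff.2 (h.comm x y)

theorem cls_add (h : IsCommSemigroupUpTo add Sim) (x y : X) :
    h.cls (add x y) = h.cls x + h.cls y := rfl

theorem completionRel_iff (h : IsCommSemigroupUpTo add Sim) {x y : X × X} :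
    CompletionRel add Sim x y ↔
      ∃ z, h.cls x.1 + h.cls y.2 + h.cls z = h.cls y.1 + h.cls x.2 + h.cls z :=
  exists_congr fun _ => h.cls_eq_iff.symm

/-- There need be no neutral element, so some stabilising summand has to be supplied; any would do.
-/
theorem completionRel_of_eq (h : IsCommSemigroupUpTo add Sim) {x y : X × X}
    (hxy : h.cls x.1 + h.cls y.2 = h.cls y.1 + h.cls x.2) : CompletionRel add Sim x y :=
  h.completionRel_iff.2 ⟨x.1, by rw [hxy]⟩

theorem equivalence_completionRel (h : IsCommSemigroupUpTo add Sim) :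
    Equivalence (CompletionRel add Sim) where
  refl x := h.completionRel_of_eq rfl
  symm := fun ⟨z, hz⟩ => ⟨z, h.equiv.symm hz⟩
  trans := by
    intro x y w hxy hyw
    obtain ⟨z, hz⟩ := h.completionRel_iff.1 hxy
    obtain ⟨z', hz'⟩ := h.completionRel_iff.1 hyw
    -- Adding the two hypotheses leaves `y.1 + y.2` on both sides, which joins `z` and `z'` in the
    -- stabiliser.
    refine h.completionRel_iff.2 ⟨add (add y.1 y.2) (add z z'), ?_⟩
    simp only [h.cls_add]
    calc _ = (h.cls x.1 + h.cls y.2 + h.cls z) + (h.cls y.1 + h.cls w.2 + h.cls z') := by ac_rfl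
      _ = (h.cls y.1 + h.cls x.2 + h.cls z) + (h.cls w.1 + h.cls y.2 + h.cls z') := by rw [hz, hz']
      _ = _ := by ac_rfl

theorem completionRel_add_right (h : IsCommSemigroupUpTo add Sim) {x x' : X × X}
    (hx : CompletionRel add Sim x x') (y : X × X) :
    CompletionRel add Sim (add x.1 y.1, add x.2 y.2) (add x'.1 y.1, add x'.2 y.2) := by
  obtain ⟨z, hz⟩ := h.completionRel_iff.1 hx
  refine h.completionRel_iff.2 ⟨z, ?_⟩
  simp only [h.cls_add]
  calc _ = (h.cls x.1 + h.cls x'.2 + h.cls z) + (h.cls y.1 + h.cls y.2) := by ac_rfl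
    _ = (h.cls x'.1 + h.cls x.2 + h.cls z) + (h.cls y.1 + h.cls y.2) := by rw [hz]
    _ = _ := by ac_rfl

/-- Negation swaps the entries of a pair, and every pair `(x, x)` represents zero; `x₀` only ensures
that there is one. -/
theorem exists_addCommGroup (h : IsCommSemigroupUpTo add Sim) (x₀ : X) :
    ∃ _ : AddCommGroup (Quot (CompletionRel add Sim)), ∀ x₁ y₁ x₂ y₂ : X,
      (Quot.mk _ (x₁, y₁) + Quot.mk _ (x₂, y₂) : Quot (CompletionRel add Sim)) =
        Quot.mk _ (add x₁ x₂, add y₁ y₂) := by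
  let _ : Add (Quot (CompletionRel add Sim)) :=
    ⟨Quot.map₂ (fun x y => (add x.1 y.1, add x.2 y.2))
      (fun x y y' hy => by
        refine h.equivalence_completionRel.trans (h.completionRel_of_eq ?_)
          (h.equivalence_completionRel.trans (h.completionRel_add_right hy x)
            (h.completionRel_of_eq ?_)) <;>
        · simp only [h.cls_add]
          ac_rfl)
      (fun x x' y hx => h.completionRel_add_right hx y)⟩
  let _ : Zero (Quot (CompletionRel add Sim)) := ⟨Quot.mk _ (x₀, x₀)⟩
  let _ : Neg (Quot (CompletionRel add Sim)) :=
    ⟨Quot.map Prod.swap (fun x y hxy => by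
      obtain ⟨z, hz⟩ := h.completionRel_iff.1 hxy
      refine h.completionRel_iff.2 ⟨z, ?_⟩
      simp only [Prod.fst_swap, Prod.snd_swap]
      rw [add_comm (h.cls x.2), add_comm (h.cls y.2)]
      exact hz.symm)⟩
  refine ⟨{ AddGroup.ofLeftAxioms ?_ ?_ ?_ with add_comm := ?_ }, fun _ _ _ _ => rfl⟩
  · rintro ⟨x⟩ ⟨y⟩ ⟨z⟩
    refine Quot.sound (h.completionRel_of_eq ?_)
    simp only [h.cls_add]
    ac_rfl
  · rintro ⟨x⟩
    refine Quot.sound (h.completionRel_of_eq ?_)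
    simp only [h.cls_add]
    ac_rfl
  · rintro ⟨x⟩
    refine Quot.sound (h.completionRel_of_eq ?_)
    simp only [h.cls_add, Prod.fst_swap, Prod.snd_swap]
    ac_rfl
  · rintro ⟨x⟩ ⟨y⟩
    refine Quot.sound (h.completionRel_of_eq ?_)
    simp only [h.cls_add]
    ac_rfl

theorem mk_congr (h : IsCommSemigroupUpTo add Sim) {x x' y y' : X} (hx : Sim x x')
    (hy : Sim y y') : (Quot.mk _ (x, y) : Quot (CompletionRel add Sim)) = Quot.mk _ (x', y') := by
  refine Quot.sound (h.completionRel_of_eq ?_)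
  rw [h.cls_eq_iff.2 hx, h.cls_eq_iff.2 hy]

section group

variable {_ : AddCommGroup (Quot (CompletionRel add Sim))}

/-- The class is idempotent. The group structure is known only through `hadd`. -/
theorem mk_self (h : IsCommSemigroupUpTo add Sim)
    (hadd : ∀ x₁ y₁ x₂ y₂ : X,
      (Quot.mk _ (x₁, y₁) + Quot.mk _ (x₂, y₂) : Quot (CompletionRel add Sim)) =
        Quot.mk _ (add x₁ x₂, add y₁ y₂))
    (x : X) :
    (Quot.mk _ (x, x) : Quot (CompletionRel add Sim)) = 0 := by
  refine (left_eq_add (a := (Quot.mk _ (x, x) : Quot (CompletionRel add Sim)))).1 ?_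
  rw [hadd]
  exact Quot.sound (h.completionRel_of_eq (by simp only [h.cls_add]; ac_rfl))

theorem mk_sub_mk (h : IsCommSemigroupUpTo add Sim)
    (hadd : ∀ x₁ y₁ x₂ y₂ : X,
      (Quot.mk _ (x₁, y₁) + Quot.mk _ (x₂, y₂) : Quot (CompletionRel add Sim)) =
        Quot.mk _ (add x₁ x₂, add y₁ y₂))
    (x y z : X) :
    (Quot.mk _ (x, z) - Quot.mk _ (y, z) : Quot (CompletionRel add Sim)) = Quot.mk _ (x, y) := by
  rw [sub_eq_iff_eq_add, hadd]
  exact Quot.sound (h.completionRel_of_eq (by simp only [h.cls_add]; ac_rfl))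

/-- Adding an element to both entries of a pair does not change its class. -/
theorem mk_add_add (h : IsCommSemigroupUpTo add Sim)
    (hadd : ∀ x₁ y₁ x₂ y₂ : X,
      (Quot.mk _ (x₁, y₁) + Quot.mk _ (x₂, y₂) : Quot (CompletionRel add Sim)) =
        Quot.mk _ (add x₁ x₂, add y₁ y₂))
    (x y z : X) :
    (Quot.mk _ (add x z, add y z) : Quot (CompletionRel add Sim)) = Quot.mk _ (x, y) := by
  rw [← hadd, h.mk_self hadd, add_zero]

/-- Universal property of the completion: cancellation in `H` removes the stabilising summand. -/
theorem exists_addMonoidHom {H : Type*} [AddCommGroup H]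
    (hadd : ∀ x₁ y₁ x₂ y₂ : X,
      (Quot.mk _ (x₁, y₁) + Quot.mk _ (x₂, y₂) : Quot (CompletionRel add Sim)) =
        Quot.mk _ (add x₁ x₂, add y₁ y₂))
    (f : X → H)
    (hf : ∀ x y, f (add x y) = f x + f y) (hsim : ∀ x y, Sim x y → f x = f y) :
    ∃ φ : Quot (CompletionRel add Sim) →+ H, ∀ x y, φ (Quot.mk _ (x, y)) = f x - f y := by
  refine ⟨AddMonoidHom.mk' (Quot.lift (fun x => f x.1 - f x.2) ?_) ?_, fun _ _ => rfl⟩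
  · rintro x y ⟨z, hz⟩
    have := hsim _ _ hz
    rw [hf, hf, hf, hf, add_left_inj] at this
    rw [sub_eq_sub_iff_add_eq_add, this]
  · rintro ⟨x⟩ ⟨y⟩
    change Quot.lift _ _ (Quot.mk _ (x.1, x.2) + Quot.mk _ (y.1, y.2)) = _
    rw [hadd]
    change f _ - f _ = (f _ - f _) + (f _ - f _)
    rw [hf, hf]
    abel

end group

end IsCommSemigroupUpTo

variable {V : Type*} [AddCommGroup V] [Module ℂ V] [StarAddMonoid V] [StarModule ℂ V] {m n : ℕ}

namespace AbsMatrixOrderUnitSpace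

variable (S : AbsMatrixOrderUnitSpace V)

/-! ### Stable homotopy -/

/-- `u ⊕ b_{k-m} ∼_h v ⊕ b_{k-n}` in `A_k` for some `k > max {m, n}`. -/
def StabHomotopic (A : ∀ n, Set (Matrix (Fin n) (Fin n) V)) (b : ∀ n, Matrix (Fin n) (Fin n) V)
    (u : Matrix (Fin m) (Fin m) V) (v : Matrix (Fin n) (Fin n) V) : Prop :=
  ∃ (k a c : ℕ) (ha : m + a = k) (hc : n + c = k), max m n < k ∧
    S.Homotopic (A k) (castSq ha (oplus u (b a))) (castSq hc (oplus v (b c)))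

/-- A family of sets of matrices which is closed under direct sums and under conjugation by scalar
unitaries, with base points `b_n`. -/
structure IsStableFamily (A : ∀ n, Set (Matrix (Fin n) (Fin n) V))
    (b : ∀ n, Matrix (Fin n) (Fin n) V) : Prop where
  base_mem : ∀ n, 0 < n → b n ∈ A n
  base_oplus : ∀ m n, oplus (b m) (b n) = b (m + n)
  oplus_mem : ∀ {m n : ℕ}, 0 < m → 0 < n → ∀ u ∈ A m, ∀ v ∈ A n, oplus u v ∈ A (m + n)
  conj_mem : ∀ {n : ℕ}, 0 < n → ∀ α : Matrix (Fin n) (Fin n) ℂ, αᴴ * α = 1 → ∀ v ∈ A n,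
    lmul α (rmul v αᴴ) ∈ A n

variable {S} {A : ∀ n, Set (Matrix (Fin n) (Fin n) V)} {b : ∀ n, Matrix (Fin n) (Fin n) V}

theorem castSq_mem {k : ℕ} (h : m = k) {u : Matrix (Fin m) (Fin m) V} (hu : u ∈ A m) :
    castSq h u ∈ A k := by
  subst h
  exact hu

theorem eq_of_permEq {x : Matrix (Fin m) (Fin m) V} {y : Matrix (Fin n) (Fin n) V}
    (h : PermEq x y) : m = n := by
  obtain ⟨σ, -⟩ := h
  exact (Fin.equiv_iff_eq.1 ⟨σ⟩).symm

namespace IsStableFamily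

theorem homotopic_of_permEq (hA : IsStableFamily A b) (hn : 0 < n)
    {v w : Matrix (Fin n) (Fin n) V} (hv : v ∈ A n) (h : PermEq v w) : S.Homotopic (A n) v w :=
  AbsMatrixOrderUnitSpace.homotopic_of_permEq hn (hA.conj_mem hn) hv h

/-- A path between permuted copies of the padded matrices suffices, as permutations are themselves
realised by paths. Positivity of `a` and `c` makes `k` strictly larger than both sizes. -/
theorem stabHomotopic_of_permEq (hA : IsStableFamily A b) (hm : 0 < m) (hn : 0 < n) {k a c : ℕ}
    (ha : 0 < a) (hc : 0 < c) {u : Matrix (Fin m) (Fin m) V} {v : Matrix (Fin n) (Fin n) V}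
    (hu : u ∈ A m) (hv : v ∈ A n) {x y : Matrix (Fin k) (Fin k) V} (hx : PermEq (oplus u (b a)) x)
    (hy : PermEq (oplus v (b c)) y) (h : S.Homotopic (A k) x y) : S.StabHomotopic A b u v := by
  have hak := eq_of_permEq hx
  have hck := eq_of_permEq hy
  have hk : 0 < k := by omega
  refine ⟨k, a, c, hak, hck, by omega, ?_⟩
  have h₁ := hA.homotopic_of_permEq (S := S) hk
    (castSq_mem hak (hA.oplus_mem hm ha u hu _ (hA.base_mem a ha))) ((permEq_castSq _ _).symm.trans hx)
  have h₂ := hA.homotopic_of_permEq (S := S) hk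
    (castSq_mem hck (hA.oplus_mem hn hc v hv _ (hA.base_mem c hc))) ((permEq_castSq _ _).symm.trans hy)
  exact homotopic_trans hk h₁ (homotopic_trans hk h (homotopic_symm hk h₂))

/-- Adding a base point to the whole path moves it to any larger size, so two stable homotopies can
be compared at a common size. -/
theorem exists_homotopic_of_stabHomotopic (hA : IsStableFamily A b)
    {u : Matrix (Fin m) (Fin m) V} {v : Matrix (Fin n) (Fin n) V} (h : S.StabHomotopic A b u v) :
    ∃ k, ∀ K, k < K → ∃ (a c : ℕ) (x y : Matrix (Fin K) (Fin K) V), 0 < a ∧ 0 < c ∧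
      PermEq (oplus u (b a)) x ∧ PermEq (oplus v (b c)) y ∧ S.Homotopic (A K) x y := by
  obtain ⟨k, a, c, ha, hc, hk, h⟩ := h
  have hk0 : 0 < k := by omega
  refine ⟨k, fun K hK => ?_⟩
  obtain ⟨j, rfl⟩ := Nat.exists_eq_add_of_lt hK
  have pad : ∀ {l d : ℕ} (hd : l + d = k) (w : Matrix (Fin l) (Fin l) V),
      PermEq (oplus w (b (d + (j + 1)))) (oplus (castSq hd (oplus w (b d))) (b (j + 1))) := by
    intro l d hd w
    rw [← hA.base_oplus]
    exact (permEq_oplus_assoc _ _ _).symm.trans ((permEq_castSq hd _).oplus (PermEq.refl _))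
  exact ⟨a + (j + 1), c + (j + 1), _, _, by omega, by omega, pad ha u, pad hc v,
    homotopic_map (mContinuous_oplus_right hk0 j.succ_pos (b (j + 1)))
      (fun x hx => hA.oplus_mem hk0 j.succ_pos x hx _ (hA.base_mem _ j.succ_pos)) h⟩

theorem stabHomotopic_trans (hA : IsStableFamily A b) {l : ℕ} (hl : 0 < l) (hn : 0 < n)
    {u : Matrix (Fin l) (Fin l) V} {v : Matrix (Fin m) (Fin m) V}
    {w : Matrix (Fin n) (Fin n) V} (hu : u ∈ A l) (hw : w ∈ A n) (h : S.StabHomotopic A b u v)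
    (h' : S.StabHomotopic A b v w) : S.StabHomotopic A b u w := by
  obtain ⟨k, hk⟩ := hA.exists_homotopic_of_stabHomotopic h
  obtain ⟨k', hk'⟩ := hA.exists_homotopic_of_stabHomotopic h'
  have hK : 0 < max k k' + 1 := by omega
  obtain ⟨a, c, x, y, ha, hc, hx, hy, hxy⟩ := hk (max k k' + 1) (by omega)
  obtain ⟨c', d, y', z, hc', hd, hy', hz, hyz⟩ := hk' (max k k' + 1) (by omega)
  obtain rfl : c = c' := by
    have := eq_of_permEq hy
    have := eq_of_permEq hy'
    omega
  have hyA : y ∈ A _ := by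
    obtain ⟨f, hf, -, -, rfl⟩ := hxy
    exact hf 1
  -- The two padded copies of `v` may differ by a permutation; a third path joins them.
  have hyy' := hA.homotopic_of_permEq (S := S) hK hyA (hy.symm.trans hy')
  exact hA.stabHomotopic_of_permEq hl hn ha hd hu hw hx hz
    (homotopic_trans hK hxy (homotopic_trans hK hyy' hyz))

theorem stabHomotopic_symm {u : Matrix (Fin m) (Fin m) V} {v : Matrix (Fin n) (Fin n) V}
    (h : S.StabHomotopic A b u v) : S.StabHomotopic A b v u := by
  obtain ⟨k, a, c, ha, hc, hk, h⟩ := h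
  exact ⟨k, c, a, hc, ha, by rwa [max_comm], homotopic_symm (by omega) h⟩

theorem stabHomotopic_oplus (hA : IsStableFamily A b) {l : ℕ} (hl : 0 < l) (hm : 0 < m) (hn : 0 < n)
    {u : Matrix (Fin l) (Fin l) V} {v : Matrix (Fin m) (Fin m) V}
    {w : Matrix (Fin n) (Fin n) V} (hu : u ∈ A l) (hv : v ∈ A m) (hw : w ∈ A n)
    (h : S.StabHomotopic A b u v) : S.StabHomotopic A b (oplus u w) (oplus v w) := by
  obtain ⟨k, hk⟩ := hA.exists_homotopic_of_stabHomotopic h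
  obtain ⟨a, c, x, y, ha, hc, hx, hy, hxy⟩ := hk (k + 1) (by omega)
  exact hA.stabHomotopic_of_permEq (by omega) (by omega) ha hc (hA.oplus_mem hl hn u hu w hw)
    (hA.oplus_mem hm hn v hv w hw)
    ((permEq_oplus_right_comm _ _ _).trans (hx.oplus (PermEq.refl w)))
    ((permEq_oplus_right_comm _ _ _).trans (hy.oplus (PermEq.refl w)))
    (homotopic_map (mContinuous_oplus_right k.succ_pos hn w)
      (fun x hx => hA.oplus_mem k.succ_pos hn x hx w hw) hxy)

theorem stabHomotopic_of_permEq_self (hA : IsStableFamily A b) (hm : 0 < m)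
    {u : Matrix (Fin m) (Fin m) V} {v : Matrix (Fin n) (Fin n) V} (hu : u ∈ A m) (hv : v ∈ A n)
    (h : PermEq u v) : S.StabHomotopic A b u v := by
  obtain rfl := eq_of_permEq h
  exact hA.stabHomotopic_of_permEq hm hm one_pos one_pos hu hv
    (h.oplus (PermEq.refl (b 1))) (PermEq.refl _)
    (homotopic_refl m.succ_pos (hA.oplus_mem hm one_pos v hv _ (hA.base_mem 1 one_pos)))

end IsStableFamily

variable (S)

theorem isStableFamily_U : IsStableFamily S.U (unitMat S.e) where
  base_mem _ hn := S.unit_mem_U hn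
  base_oplus := oplus_unitMat S.e
  oplus_mem hm hn _ hu _ hv := S.oplus_mem_U hm hn hu hv
  conj_mem hn _ hα _ hv := S.conj_mem_U hn hα hv

theorem isStableFamily_PU : IsStableFamily S.PU fun _ => 0 where
  base_mem _ hn := S.zero_mem_PU hn
  base_oplus _ _ := oplus_zero_zero
  oplus_mem hm hn _ hu _ hv := S.oplus_mem_PU hm hn hu hv
  conj_mem hn _ hα _ hv := S.conj_mem_PU hn hα hv

theorem isCommSemigroupUpTo_UInf : IsCommSemigroupUpTo (UInf.sum (S := S)) UInf.Sim where
  equiv :=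
    { refl := fun u => S.isStableFamily_U.stabHomotopic_of_permEq_self u.hn u.mem u.mem (.refl _)
      symm := fun h => IsStableFamily.stabHomotopic_symm h
      trans := fun {u _ w} h h' =>
        S.isStableFamily_U.stabHomotopic_trans u.hn w.hn u.mem w.mem h h' }
  congr_left {u v} w h :=
    S.isStableFamily_U.stabHomotopic_oplus u.hn v.hn w.hn u.mem v.mem w.mem h
  comm u v := S.isStableFamily_U.stabHomotopic_of_permEq_self (u.sum v).hn (u.sum v).mem
    (v.sum u).mem (permEq_oplus_comm _ _)
  assoc u v w := S.isStableFamily_U.stabHomotopic_of_permEq_self ((u.sum v).sum w).hn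
    ((u.sum v).sum w).mem (u.sum (v.sum w)).mem (permEq_oplus_assoc _ _ _)

theorem isCommSemigroupUpTo_PUInf : IsCommSemigroupUpTo (PUInf.sum (S := S)) PUInf.Sim where
  equiv :=
    { refl := fun u => S.isStableFamily_PU.stabHomotopic_of_permEq_self u.hn u.mem u.mem (.refl _)
      symm := fun h => IsStableFamily.stabHomotopic_symm (b := fun _ => 0) h
      trans := fun {u _ w} h h' =>
        S.isStableFamily_PU.stabHomotopic_trans u.hn w.hn u.mem w.mem h h' }
  congr_left {u v} w h :=
    S.isStableFamily_PU.stabHomotopic_oplus u.hn v.hn w.hn u.mem v.mem w.mem h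
  comm u v := S.isStableFamily_PU.stabHomotopic_of_permEq_self (u.sum v).hn (u.sum v).mem
    (v.sum u).mem (permEq_oplus_comm _ _)
  assoc u v w := S.isStableFamily_PU.stabHomotopic_of_permEq_self ((u.sum v).sum w).hn
    ((u.sum v).sum w).mem (u.sum (v.sum w)).mem (permEq_oplus_assoc _ _ _)

/-! ### Partial isometric equivalence -/

variable {S}

/-- The linking partial isometry is `p` with only its columns permuted. -/
theorem pIEquiv_of_permEq (hm : 0 < m) (hn : 0 < n) {p : Matrix (Fin m) (Fin m) V}
    {q : Matrix (Fin n) (Fin n) V} (hp : p ∈ S.OP m) (hq : q ∈ S.OP n) (h : PermEq p q) :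
    S.PIEquiv p q := by
  obtain ⟨σ, rfl⟩ := h
  have hpp := S.abs_of_pos hm (S.mem_pos_of_mem_OP hm hp)
  have h₁ : S.abs m n (p.submatrix id σ) = p.submatrix σ σ := by
    rw [← Equiv.coe_refl, S.abs_submatrix hm hm hm hn, hpp]
  have h₂ : S.abs n m (p.submatrix id σ)ᴴ = p := by
    rw [conjTranspose_submatrix, hp.1, ← Equiv.coe_refl, S.abs_submatrix hn hm hm hm, hpp]
    rfl
  refine ⟨p.submatrix id σ, ⟨?_, ?_⟩, h₂.symm, h₁.symm⟩
  · rwa [h₁]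
  · rwa [h₂]

theorem pIEquiv_symm {p : Matrix (Fin m) (Fin m) V} {q : Matrix (Fin n) (Fin n) V}
    (h : S.PIEquiv p q) : S.PIEquiv q p := by
  obtain ⟨v, hv, hp, hq⟩ := h
  refine ⟨vᴴ, ⟨hv.2, ?_⟩, ?_, hp⟩
  · rw [conjTranspose_conjTranspose]
    exact hv.1
  · rwa [conjTranspose_conjTranspose]

/-- (T) is applied to `u` and `vᴴ`, whose absolute values are both `q`. -/
theorem pIEquiv_trans (hT : S.CondT) {l : ℕ} (hl : 0 < l) (hm : 0 < m) (hn : 0 < n)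
    {p : Matrix (Fin l) (Fin l) V} {q : Matrix (Fin m) (Fin m) V} {r : Matrix (Fin n) (Fin n) V}
    (h : S.PIEquiv p q) (h' : S.PIEquiv q r) : S.PIEquiv p r := by
  obtain ⟨u, hu, rfl, rfl⟩ := h
  obtain ⟨v, hv, hq, rfl⟩ := h'
  obtain ⟨w, hw, h₁, h₂⟩ := hT l m n hl hm hn u hu vᴴ
    ⟨hv.2, by rw [conjTranspose_conjTranspose]; exact hv.1⟩ hq
  rw [conjTranspose_conjTranspose] at h₂
  exact ⟨w, hw, h₁.symm, h₂.symm⟩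

theorem pIEquiv_oplus {m' n' : ℕ} (hm : 0 < m) (hn : 0 < n) (hm' : 0 < m') (hn' : 0 < n')
    {p : Matrix (Fin m) (Fin m) V} {q : Matrix (Fin n) (Fin n) V}
    {p' : Matrix (Fin m') (Fin m') V} {q' : Matrix (Fin n') (Fin n') V}
    (h : S.PIEquiv p q) (h' : S.PIEquiv p' q') : S.PIEquiv (oplus p p') (oplus q q') := by
  obtain ⟨u, hu, rfl, rfl⟩ := h
  obtain ⟨v, hv, rfl, rfl⟩ := h'
  have h₁ := S.abs_oplus m n m' n' hm hn hm' hn' u v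
  have h₂ := S.abs_oplus n m n' m' hn hm hn' hm' uᴴ vᴴ
  rw [← conjTranspose_oplus] at h₂
  refine ⟨oplus u v, ⟨?_, ?_⟩, h₂.symm, h₁.symm⟩
  · rw [h₁]
    exact S.oplus_mem_OP hn hn' hu.1 hv.1
  · rw [h₂]
    exact S.oplus_mem_OP hm hm' hu.2 hv.2

/-- Zeros of different sizes are equivalent, so padding by zeros is invisible in `K₀`. -/
theorem pIEquiv_zero (hm : 0 < m) (hn : 0 < n) :
    S.PIEquiv (0 : Matrix (Fin m) (Fin m) V) (0 : Matrix (Fin n) (Fin n) V) := by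
  have h₁ := S.abs_zero hm hn
  have h₂ : S.abs n m (0 : Matrix (Fin m) (Fin n) V)ᴴ = 0 := by
    rw [conjTranspose_zero, S.abs_zero hn hm]
  refine ⟨0, ⟨?_, ?_⟩, h₂.symm, h₁.symm⟩
  · rw [h₁]
    exact S.zero_mem_OP hn
  · rw [h₂]
    exact S.zero_mem_OP hm

theorem isCommSemigroupUpTo_OPInf (hT : S.CondT) :
    IsCommSemigroupUpTo (OPInf.sum (S := S)) OPInf.Sim where
  equiv :=
    { refl := fun p => pIEquiv_of_permEq p.hn p.hn p.mem p.mem (.refl _)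
      symm := fun h => pIEquiv_symm h
      trans := fun {p q r} h h' => pIEquiv_trans hT p.hn q.hn r.hn h h' }
  congr_left {p q} r h :=
    pIEquiv_oplus p.hn q.hn r.hn r.hn h (pIEquiv_of_permEq r.hn r.hn r.mem r.mem (.refl _))
  comm p q := pIEquiv_of_permEq (p.sum q).hn (q.sum p).hn (p.sum q).mem (q.sum p).mem
    (permEq_oplus_comm _ _)
  assoc p q r := pIEquiv_of_permEq ((p.sum q).sum r).hn (p.sum (q.sum r)).hn ((p.sum q).sum r).mem
    (p.sum (q.sum r)).mem (permEq_oplus_assoc _ _ _)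

end AbsMatrixOrderUnitSpace

end AMOU

/-! ### Projections and unitaries inside the partial unitaries. -/

namespace AMOU

variable {V : Type*} [AddCommGroup V] [Module ℂ V] [StarAddMonoid V] [StarModule ℂ V] {m n : ℕ}

namespace AbsMatrixOrderUnitSpace

variable (S : AbsMatrixOrderUnitSpace V)

theorem unit_mem_OP (hn : 0 < n) : unitMat S.e n ∈ S.OP n := by
  refine ⟨S.isHermitian_unitMat hn, ?_⟩
  rw [two_smul, add_sub_cancel_right, S.abs_of_pos hn (S.unit_mem_pos hn)]

theorem mem_PU_of_mem_OP (hn : 0 < n) {p : Matrix (Fin n) (Fin n) V} (hp : p ∈ S.OP n) :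
    p ∈ S.PU n := by
  refine ⟨by rw [hp.1], ?_⟩
  rwa [S.abs_of_pos hn (S.mem_pos_of_mem_OP hn hp)]

theorem mem_PU_of_mem_U (hn : 0 < n) {u : Matrix (Fin n) (Fin n) V} (hu : u ∈ S.U n) :
    u ∈ S.PU n := by
  refine ⟨hu.1.trans hu.2.symm, ?_⟩
  rw [hu.1]
  exact S.unit_mem_OP hn

variable {S}

/-- An order projection, as a partial unitary. -/
def OPInf.toPUInf (p : S.OPInf) : S.PUInf := ⟨p.n, p.hn, p.val, S.mem_PU_of_mem_OP p.hn p.mem⟩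

/-- A unitary, as a partial unitary. -/
def UInf.toPUInf (u : S.UInf) : S.PUInf := ⟨u.n, u.hn, u.val, S.mem_PU_of_mem_U u.hn u.mem⟩

variable (S) in
/-- `eⁿ ∈ U_n(V)`. -/
def UInf.unitOfSize (n : ℕ) (hn : 0 < n) : S.UInf := ⟨n, hn, unitMat S.e n, S.unit_mem_U hn⟩

variable (S) in
/-- `eⁿ ∈ OP_n(V)`. -/
def OPInf.unitOfSize (n : ℕ) (hn : 0 < n) : S.OPInf := ⟨n, hn, unitMat S.e n, S.unit_mem_OP hn⟩

variable (S) in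
/-- `0 ∈ OP_n(V)`. -/
def OPInf.zeroOfSize (n : ℕ) (hn : 0 < n) : S.OPInf := ⟨n, hn, 0, S.zero_mem_OP hn⟩

/-- The unitary `u + eⁿ - |u|` of a partial unitary `u`. -/
def PUInf.toUnitary (u : S.PUInf) : S.UInf :=
  ⟨u.n, u.hn, _, S.add_unit_sub_abs_mem_U u.hn u.mem⟩

theorem OPInf.mk_congr {hn : 0 < n} {p q : Matrix (Fin n) (Fin n) V} {hp : p ∈ S.OP n}
    {hq : q ∈ S.OP n} (h : p = q) : (⟨n, hn, p, hp⟩ : S.OPInf) = ⟨n, hn, q, hq⟩ := by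
  subst h
  rfl

theorem UInf.mk_congr {hn : 0 < n} {u v : Matrix (Fin n) (Fin n) V} {hu : u ∈ S.U n}
    {hv : v ∈ S.U n} (h : u = v) : (⟨n, hn, u, hu⟩ : S.UInf) = ⟨n, hn, v, hv⟩ := by
  subst h
  rfl

theorem toUnitary_oplus (hm : 0 < m) (hn : 0 < n) (u : Matrix (Fin m) (Fin m) V)
    (v : Matrix (Fin n) (Fin n) V) :
    oplus u v + unitMat S.e (m + n) - S.abs (m + n) (m + n) (oplus u v) =
      oplus (u + unitMat S.e m - S.abs m m u) (v + unitMat S.e n - S.abs n n v) := by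
  rw [S.abs_oplus m m n n hm hm hn hn, ← oplus_unitMat, oplus_add_oplus, oplus_sub_oplus]

theorem PUInf.absProj_sum (u v : S.PUInf) : (u.sum v).absProj = u.absProj.sum v.absProj :=
  OPInf.mk_congr (S.abs_oplus _ _ _ _ u.hn u.hn v.hn v.hn u.val v.val)

theorem PUInf.toUnitary_sum (u v : S.PUInf) : (u.sum v).toUnitary = u.toUnitary.sum v.toUnitary :=
  UInf.mk_congr (toUnitary_oplus u.hn v.hn u.val v.val)

theorem OPInf.absProj_toPUInf (p : S.OPInf) : p.toPUInf.absProj = p :=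
  OPInf.mk_congr (S.abs_of_pos p.hn (S.mem_pos_of_mem_OP p.hn p.mem))

theorem OPInf.toUnitary_toPUInf (p : S.OPInf) :
    p.toPUInf.toUnitary = UInf.unitOfSize S p.n p.hn := by
  refine UInf.mk_congr ?_
  change p.val + unitMat S.e p.n - S.abs p.n p.n p.val = _
  rw [S.abs_of_pos p.hn (S.mem_pos_of_mem_OP p.hn p.mem), add_sub_cancel_left]

theorem UInf.absProj_toPUInf (u : S.UInf) : u.toPUInf.absProj = OPInf.unitOfSize S u.n u.hn :=
  OPInf.mk_congr u.mem.1

theorem UInf.toUnitary_toPUInf (u : S.UInf) : u.toPUInf.toUnitary = u := by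
  refine UInf.mk_congr ?_
  change u.val + unitMat S.e u.n - S.abs u.n u.n u.val = _
  rw [u.mem.1, add_sub_cancel_right]

theorem sim_unitOfSize (hm : 0 < m) (hn : 0 < n) :
    (UInf.unitOfSize S m hm).Sim (UInf.unitOfSize S n hn) := by
  have e : ∀ {l a k : ℕ} (h : l + a = k), castSq h (oplus (unitMat S.e l) (unitMat S.e a)) =
      unitMat S.e k := by
    rintro l a k rfl
    exact oplus_unitMat _ _ _
  refine ⟨m + n, n, m, rfl, add_comm n m, max_lt (Nat.lt_add_of_pos_right hn)
    (Nat.lt_add_of_pos_left hm), ?_⟩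
  change S.Homotopic (S.U (m + n))
    (castSq (rfl : m + n = m + n) (oplus (unitMat S.e m) (unitMat S.e n)))
    (castSq (add_comm n m) (oplus (unitMat S.e n) (unitMat S.e m)))
  rw [e, e]
  exact homotopic_refl (by omega) (S.unit_mem_U (by omega))

theorem abs_castSq_oplus_zero {k a : ℕ} (hm : 0 < m) (ha : 0 < a) (h : m + a = k)
    (u : Matrix (Fin m) (Fin m) V) :
    S.abs k k (castSq h (oplus u (0 : Matrix (Fin a) (Fin a) V))) =
      castSq h (oplus (S.abs m m u) (0 : Matrix (Fin a) (Fin a) V)) := by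
  subst h
  change S.abs _ _ (oplus u 0) = oplus _ 0
  rw [S.abs_oplus m m a a hm hm ha ha, S.abs_zero ha ha]

/-- Completion takes the zero padding used for `∼_K` to the unit padding used for `∼₁`. -/
theorem toUnitary_castSq_oplus_zero {k a : ℕ} (hm : 0 < m) (ha : 0 < a) (h : m + a = k)
    (u : Matrix (Fin m) (Fin m) V) :
    castSq h (oplus u (0 : Matrix (Fin a) (Fin a) V)) + unitMat S.e k -
        S.abs k k (castSq h (oplus u (0 : Matrix (Fin a) (Fin a) V))) =
      castSq h (oplus (u + unitMat S.e m - S.abs m m u) (unitMat S.e a)) := by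
  subst h
  change oplus u 0 + unitMat S.e (m + a) - S.abs _ _ (oplus u 0) = oplus _ _
  rw [toUnitary_oplus hm ha, S.abs_zero ha ha, zero_add, sub_zero]

theorem PUInf.Sim.toUnitary (hcont : ∀ n : ℕ, 0 < n → S.AbsContinuous n) {u v : S.PUInf}
    (h : u.Sim v) : u.toUnitary.Sim v.toUnitary := by
  obtain ⟨k, a, c, ha, hc, hk, h⟩ := h
  have hk0 : 0 < k := by omega
  refine ⟨k, a, c, ha, hc, hk, ?_⟩
  have h' := homotopic_map (mContinuous_add_sub_abs hk0 (hcont k hk0))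
    (fun x hx => S.add_unit_sub_abs_mem_U hk0 hx) h
  beta_reduce at h'
  rwa [toUnitary_castSq_oplus_zero u.hn (by omega) ha,
    toUnitary_castSq_oplus_zero v.hn (by omega) hc] at h'

/-- Absolute values along the path form a path of projections of size `k`. The zero summands remain
here and disappear only in `K₀`. -/
theorem PUInf.Sim.exists_absProj (hT : S.CondT) (hcont : ∀ n : ℕ, 0 < n → S.AbsContinuous n)
    (hhom : ∀ n : ℕ, 0 < n → ∀ p ∈ S.OP n, ∀ q ∈ S.OP n,
      S.Homotopic (S.OP n) p q → S.PIEquiv p q) {u v : S.PUInf} (h : u.Sim v) :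
    ∃ (a c : ℕ) (ha : 0 < a) (hc : 0 < c),
      (u.absProj.sum (OPInf.zeroOfSize S a ha)).Sim (v.absProj.sum (OPInf.zeroOfSize S c hc)) := by
  obtain ⟨k, a, c, hak, hck, hk, h⟩ := h
  have hk0 : 0 < k := by omega
  have ha : 0 < a := by omega
  have hc : 0 < c := by omega
  refine ⟨a, c, ha, hc, ?_⟩
  have h' := homotopic_map (hcont k hk0) (fun x hx => (hx.2 : S.abs k k x ∈ S.OP k)) h
  rw [abs_castSq_oplus_zero u.hn ha hak, abs_castSq_oplus_zero v.hn hc hck] at h'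
  have hp := (u.absProj.sum (OPInf.zeroOfSize S a ha)).mem
  have hq := (v.absProj.sum (OPInf.zeroOfSize S c hc)).mem
  have hp' := castSq_mem (A := S.OP) hak hp
  have hq' := castSq_mem (A := S.OP) hck hq
  have h₁ := pIEquiv_of_permEq (OPInf.hn _) hk0 hp hp' (permEq_castSq hak _)
  have h₂ := pIEquiv_of_permEq hk0 (OPInf.hn _) hq' hq (permEq_castSq hck _).symm
  exact pIEquiv_trans hT (OPInf.hn _) hk0 (OPInf.hn _) h₁
    (pIEquiv_trans hT hk0 hk0 (OPInf.hn _) (hhom k hk0 _ hp' _ hq' h') h₂)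

end AbsMatrixOrderUnitSpace

end AMOU

/-! ### The groups and the homomorphism `θ`. -/

open AMOU AbsMatrixOrderUnitSpace in
theorem theorem5p8 {V : Type*} [AddCommGroup V] [Module ℂ V] [StarAddMonoid V] [StarModule ℂ V]
    (S : AbsMatrixOrderUnitSpace V)
    (hT : S.CondT)
    (hcont : ∀ n : ℕ, 0 < n → S.AbsContinuous n)
    (hhom : ∀ n : ℕ, 0 < n → ∀ p ∈ S.OP n, ∀ q ∈ S.OP n,
      S.Homotopic (S.OP n) p q → S.PIEquiv p q) :
    Equivalence S.K0Rel ∧ Equivalence S.K1Rel ∧ Equivalence S.KRel ∧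
    ∃ (_ : AddCommGroup S.K0) (_ : AddCommGroup S.K1) (_ : AddCommGroup S.K),
      (∀ p₁ q₁ p₂ q₂ : S.OPInf, K0.mk p₁ q₁ + K0.mk p₂ q₂ = K0.mk (p₁.sum p₂) (q₁.sum q₂)) ∧
      (∀ u₁ v₁ u₂ v₂ : S.UInf, K1.mk u₁ v₁ + K1.mk u₂ v₂ = K1.mk (u₁.sum u₂) (v₁.sum v₂)) ∧
      (∀ u₁ v₁ u₂ v₂ : S.PUInf, K.mk u₁ v₁ + K.mk u₂ v₂ = K.mk (u₁.sum u₂) (v₁.sum v₂)) ∧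
      ∃ θ : S.K →+ S.K0 × S.K1,
        Function.Surjective θ ∧
        (∀ u : S.PUInf, ∃ h : u.val + unitMat S.e u.n - S.abs u.n u.n u.val ∈ S.U u.n,
          θ (K.mk u (PUInf.zero S)) =
            (K0.mk u.absProj (OPInf.zero S), K1.mk ⟨u.n, u.hn, _, h⟩ (UInf.unit S))) ∧
        Nonempty (S.K ⧸ θ.ker ≃+ S.K0 × S.K1) := by
  have h0 := isCommSemigroupUpTo_OPInf hT
  have h1 := S.isCommSemigroupUpTo_UInf
  have hK := S.isCommSemigroupUpTo_PUInf
  refine ⟨h0.equivalence_completionRel, h1.equivalence_completionRel,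
    hK.equivalence_completionRel, ?_⟩
  obtain ⟨g0, add0⟩ : ∃ _ : AddCommGroup S.K0, ∀ p₁ q₁ p₂ q₂ : S.OPInf,
    K0.mk p₁ q₁ + K0.mk p₂ q₂ = K0.mk (p₁.sum p₂) (q₁.sum q₂) :=
    h0.exists_addCommGroup (OPInf.zero S)
  obtain ⟨g1, add1⟩ : ∃ _ : AddCommGroup S.K1, ∀ u₁ v₁ u₂ v₂ : S.UInf,
    K1.mk u₁ v₁ + K1.mk u₂ v₂ = K1.mk (u₁.sum u₂) (v₁.sum v₂) :=
    h1.exists_addCommGroup (UInf.unit S)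
  obtain ⟨gK, addK⟩ : ∃ _ : AddCommGroup S.K, ∀ u₁ v₁ u₂ v₂ : S.PUInf,
    K.mk u₁ v₁ + K.mk u₂ v₂ = K.mk (u₁.sum u₂) (v₁.sum v₂) :=
    hK.exists_addCommGroup (PUInf.zero S)
  refine ⟨g0, g1, gK, add0, add1, addK, ?_⟩
  have cong0 : ∀ {p p' q q' : S.OPInf}, p.Sim p' → q.Sim q' → K0.mk p q = K0.mk p' q' :=
    fun hp hq => h0.mk_congr hp hq
  have cong1 : ∀ {u u' v v' : S.UInf}, u.Sim u' → v.Sim v' → K1.mk u v = K1.mk u' v' :=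
    fun hu hv => h1.mk_congr hu hv
  have self0 : ∀ p : S.OPInf, K0.mk p p = 0 := h0.mk_self add0
  have self1 : ∀ u : S.UInf, K1.mk u u = 0 := h1.mk_self add1
  have zero_sim : ∀ {m : ℕ} (hm : 0 < m), (OPInf.zero S).Sim (OPInf.zeroOfSize S m hm) :=
    fun hm => pIEquiv_zero one_pos hm
  have two_zero : ((OPInf.zero S).sum (OPInf.zero S)).Sim (OPInf.zero S) := by
    have : (OPInf.zero S).sum (OPInf.zero S) = OPInf.zeroOfSize S (1 + 1) two_pos :=
      OPInf.mk_congr oplus_zero_zero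
    rw [this]
    exact h0.equiv.symm (zero_sim _)
  have two_unit : ((UInf.unit S).sum (UInf.unit S)).Sim (UInf.unit S) := by
    have : (UInf.unit S).sum (UInf.unit S) = UInf.unitOfSize S (1 + 1) two_pos :=
      UInf.mk_congr (oplus_unitMat _ _ _)
    rw [this]
    exact sim_unitOfSize _ one_pos
  -- the map `u ↦ ([(|u|, 0)], [(u + e - |u|, e)])`
  let f : S.PUInf → S.K0 × S.K1 := fun u =>
    (K0.mk u.absProj (OPInf.zero S), K1.mk u.toUnitary (UInf.unit S))
  have f_add : ∀ u v, f (u.sum v) = f u + f v := by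
    intro u v
    refine Prod.ext ?_ ?_
    · change K0.mk _ _ = K0.mk _ _ + K0.mk _ _
      rw [add0, PUInf.absProj_sum]
      exact cong0 (h0.equiv.refl _) (h0.equiv.symm two_zero)
    · change K1.mk _ _ = K1.mk _ _ + K1.mk _ _
      rw [add1, PUInf.toUnitary_sum]
      exact cong1 (h1.equiv.refl _) (h1.equiv.symm two_unit)
  -- The second entry `0` may be replaced by `0 ⊕ 0_a`, after which the common summand `0_a`
  -- cancels.
  have drop_zero : ∀ (p : S.OPInf) {a : ℕ} (ha : 0 < a),
      K0.mk (p.sum (OPInf.zeroOfSize S a ha)) (OPInf.zero S) = K0.mk p (OPInf.zero S) := by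
    intro p a ha
    refine (cong0 (h0.equiv.refl _) (h0.equiv.symm ?_)).trans
      (h0.mk_add_add add0 p (OPInf.zero S) (OPInf.zeroOfSize S a ha))
    exact h0.equiv.trans (h0.congr (h0.equiv.refl _) (h0.equiv.symm (zero_sim ha))) two_zero
  have f_sim : ∀ u v : S.PUInf, u.Sim v → f u = f v := by
    intro u v huv
    refine Prod.ext ?_ (cong1 (huv.toUnitary hcont) (h1.equiv.refl _))
    obtain ⟨a, c, ha, hc, h⟩ := huv.exists_absProj hT hcont hhom
    change K0.mk _ _ = K0.mk _ _
    rw [← drop_zero u.absProj ha, ← drop_zero v.absProj hc]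
    exact cong0 h (h0.equiv.refl _)
  obtain ⟨θ, hθ⟩ : ∃ θ : S.K →+ S.K0 × S.K1, ∀ u v, θ (K.mk u v) = f u - f v :=
    IsCommSemigroupUpTo.exists_addMonoidHom addK f f_add f_sim
  have f_zero : f (PUInf.zero S) = 0 := by
    have e : PUInf.zero S = (OPInf.zero S).toPUInf := rfl
    refine Prod.ext ?_ ?_
    · change K0.mk _ _ = 0
      rw [e, OPInf.absProj_toPUInf, self0]
    · change K1.mk _ _ = 0
      rw [e, OPInf.toUnitary_toPUInf]
      exact self1 (UInf.unit S)
  have surj : Function.Surjective θ := by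
    have unit_zero : ∀ {m : ℕ} (hm : 0 < m), K1.mk (UInf.unitOfSize S m hm) (UInf.unit S) = 0 :=
      fun hm => (cong1 (sim_unitOfSize hm one_pos) (h1.equiv.refl _)).trans (self1 (UInf.unit S))
    have f_OP : ∀ p : S.OPInf, f p.toPUInf = (K0.mk p (OPInf.zero S), 0) := by
      intro p
      refine Prod.ext ?_ ?_
      · change K0.mk _ _ = _
        rw [OPInf.absProj_toPUInf]
      · change K1.mk _ _ = _
        rw [OPInf.toUnitary_toPUInf, unit_zero]
    have f_U : ∀ u : S.UInf, f u.toPUInf =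
        (K0.mk (OPInf.unitOfSize S u.n u.hn) (OPInf.zero S), K1.mk u (UInf.unit S)) := by
      intro u
      refine Prod.ext ?_ ?_
      · change K0.mk _ _ = _
        rw [UInf.absProj_toPUInf]
      · change K1.mk _ _ = _
        rw [UInf.toUnitary_toPUInf]
    rintro ⟨⟨p, q⟩, ⟨u, v⟩⟩
    -- The first term hits `([(p, q)], 0)`. Pairing each unitary with the unit of its own size
    -- cancels its `K₀` component, leaving `[(u, e)] - [(v, e)] = [(u, v)]` in `K₁`.
    refine ⟨K.mk p.toPUInf q.toPUInf +
      (K.mk u.toPUInf (OPInf.unitOfSize S u.n u.hn).toPUInf -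
        K.mk v.toPUInf (OPInf.unitOfSize S v.n v.hn).toPUInf), ?_⟩
    rw [map_add, map_sub, hθ, hθ, hθ, f_OP, f_OP, f_OP, f_OP, f_U, f_U]
    refine Prod.ext ?_ ?_
    · simp only [Prod.fst_add, Prod.fst_sub, sub_self, add_zero]
      exact h0.mk_sub_mk add0 p q (OPInf.zero S)
    · simp only [Prod.snd_add, Prod.snd_sub, sub_zero, zero_add]
      exact h1.mk_sub_mk add1 u v (UInf.unit S)
  refine ⟨θ, surj, fun u => ⟨S.add_unit_sub_abs_mem_U u.hn u.mem, ?_⟩,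
    ⟨QuotientAddGroup.quotientKerEquivOfSurjective θ surj⟩⟩
  rw [hθ, f_zero, sub_zero]
  rfl
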